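/- **Conventions.** A Lévy measure on $(0,\infty)$ is a Borel measure $\rho$ with $\int_0^\infty \min(1,x)\,\rho(dx)<\infty$; it is trivial if $\rho=0$. Write $\overline\rho(x)=\rho((x,\infty))$ for $x\ge 0$ and $\overline\rho^{-1}(u)=\inf\{x>0:\overline\rho(x)<u\}$ for $u>0$. For $a\ge 0$, $\mathrm{ID}(a,\rho)$ is the law on $[0,\infty)$ with Laplace transform $t\mapsto \exp\bigl(-ta-\int_0^\infty(1-e^{-wt})\rho(dw)\bigr)$, $t\ge 0$. $\mathrm{Gamma}(\alpha,\beta)$ has shape $\alpha$ and rate $\beta$. For nonnegative $x_1,\dots,x_p$, $x_{(1)}\ge x_{(2)}\ge\dots\ge x_{(p)}$ are the values in decreasing order and $x_{(k)}=0$ for $k>p$. Let $a\ge 0$ and let $\rho$ be a Lévy measure on $(0,\infty)$. **1. Limit variables.** Suppose $\rho\neq 0$, let $k\ge 1$ and $G_k\sim\mathrm{Gamma}(k,1)$. Then $\overline\rho^{-1}(G_k)$ is a nonnegative random variable, not almost surely $0$, and its cdf $F_k$ satisfies $$F_k(x)=e^{-\overline\rho(x)}\sum_{i=0}^{k-1}\frac{\overline\rho(x)^i}{i!}\quad\text{for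 every } x>0 \text{ with } \rho(\{x\})=0,$$ while $F_k(0)=e^{-\overline\rho(0)}\sum_{i=0}^{k-1}\overline\rho(0)^i/i!$ if $\rho$ is finite, and $F_k(0)=0$ if $\rho$ is infinite. **2. Triangular arrays.** For each $p\ge 1$ let $X_{p,1},\dots,X_{p,p}$ be iid nonnegative random variables, and suppose that $\sum_{j=1}^p X_{p,j}$ converges in distribution to $\mathrm{ID}(a,\rho)$ as $p\to\infty$. If $\rho=0$, then $X_{p,(k)}\to 0$ in probability for every $k\ge 1$. If $\rho\ne 0$ and $G_1<G_2<\cdots$ are the ordered points of a rate one Poisson process on $(0,\infty)$, then $G_k\sim\mathrm{Gamma}(k,1)$ for every $k\geq 1$ and, jointly in $k$ (in $\mathbb R^{\mathbb N}$ with the product topology), $$\bigl(X_{p,(k)}\bigr)_{k\ge1}\ \longrightarrow\ \bigl(\overline\rho^{-1}(G_k)\bigr)_{k\ge1}\quad\text{in distribution.}$$ **3. Networks.** Consider a feedforward network with $L$ hidden layers of widths $p_1,\dots,p_L\ge 1$, input dimension $p_0=d_{\mathrm{in}}$ and output dimension $p_{L+1}=d_{\mathrm{out}}$. For $0\le l\le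 L$, the weight from node $j$ of layer $l$ to node $m$ of layer $l+1$ is $W^{(l+1)}_{jm}=\sqrt{\lambda^{(l)}_{p_l,j}}\,V^{(l+1)}_{jm}$, where $V^{(l+1)}_{jm}\sim\mathcal N(0,\sigma_v^2)$ with $\sigma_v>0$, $\lambda^{(0)}_{p_0,j}=1/d_{\mathrm{in}}$, and for $1\le l\le L$ the node variance $\lambda^{(l)}_{p_l,j}$ has a law $\mu^{(l)}_{p_l}$ on $[0,\infty)$; the biases are $B^{(l)}_m\sim\mathcal N(0,\sigma_b^2)$ with $\sigma_b\ge 0$. For each choice of widths, all the variables $\lambda$, $V$, $B$ are independent. Fix $l\in\{1,\dots,L\}$ and suppose that $\sum_{j=1}^{p_l}\lambda^{(l)}_{p_l,j}$ converges in distribution to $\mathrm{ID}(a,\rho)$ as $p_l\to\infty$. Let $\nu$ be defined by $\nu(A)=\int_0^\infty \rho(\{w: xw\in A\})\,\gamma(dx)$ with $\gamma=\mathrm{Gamma}(1/2,1/2)$. Then $\nu$ is a Lévy measure on $(0,\infty)$, and $\nu=0$ if and only if $\rho=0$. Let $k\ge1$, $G_k\sim\mathrm{Gamma}(k,1)$,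 and let $m$ be a node of layer $l+1$. As $p_l\to\infty$: * the $k$-th largest of $\lambda^{(l)}_{p_l,1},\dots,\lambda^{(l)}_{p_l,p_l}$ converges in probability to $0$ if $\rho=0$, and converges in distribution to $\overline\rho^{-1}(G_k)$ otherwise; * the $k$-th largest of the squared incoming weights $(W^{(l+1)}_{1m})^2,\dots,(W^{(l+1)}_{p_l m})^2$ converges in probability to $0$ if $\rho=0$, and converges in distribution to $\sigma_v^2\,\overline\nu^{-1}(G_k)$ otherwise. -/

import Mathlib

open MeasureTheory ProbabilityTheory Filter Set
open scoped Topology ENNReal NNReal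

noncomputable section

/-! ## Lévy measures on `(0, ∞)` and infinitely divisible laws on `[0, ∞)` -/

/-- A Lévy measure on `(0, ∞)`, viewed as a Borel measure on `ℝ` that does not charge `(-∞, 0]`:
`∫ min(1, x) ρ(dx) < ∞`. -/
structure IsLevyMeasure (ρ : Measure ℝ) : Prop where
  nonpos_null : ρ (Iic 0) = 0
  lintegral_lt_top : ∫⁻ x, ENNReal.ofReal (min 1 x) ∂ρ < ∞

/-- The tail Lévy measure `x ↦ ρ((x, ∞))`. At `x = 0` this is the total mass `ρ((0, ∞))`. -/
def levyTail (ρ : Measure ℝ) (x : ℝ) : ℝ≥0∞ := ρ (Ioi x)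

/-- The inverse tail Lévy intensity `u ↦ inf {x > 0 : ρ((x, ∞)) < u}` (used for `u > 0`). -/
def invLevyTail (ρ : Measure ℝ) (u : ℝ) : ℝ :=
  sInf {x : ℝ | 0 < x ∧ levyTail ρ x < ENNReal.ofReal u}

/-- `κ` is the infinitely divisible law `ID(a, ρ)` on `[0, ∞)`: its Laplace transform is
`t ↦ exp(-t a - ∫ (1 - exp(-w t)) ρ(dw))`. -/
structure IsIDLaw (a : ℝ) (ρ : Measure ℝ) (κ : Measure ℝ) : Prop where
  isProbabilityMeasure : IsProbabilityMeasure κ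
  neg_null : κ (Iio 0) = 0
  laplace : ∀ t : ℝ, 0 ≤ t →
    ∫ x, Real.exp (-(t * x)) ∂κ =
      Real.exp (-(t * a) - ∫ w, (1 - Real.exp (-(w * t))) ∂ρ)

/-- The real random variables `S n` converge in distribution to `ID(a, ρ)`. -/
def TendstoID {Ω : Type*} [MeasurableSpace Ω] (P : Measure Ω) [IsProbabilityMeasure P]
    (S : ℕ → Ω → ℝ) (a : ℝ) (ρ : Measure ℝ) : Prop :=
  ∃ κ : ProbabilityMeasure ℝ, IsIDLaw a ρ (κ : Measure ℝ) ∧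
    TendstoInDistribution S atTop (id : ℝ → ℝ) (fun _ => P) (κ : Measure ℝ)

/-- The measure `ν(dz) = ∫ ρ(dz / x) Gamma(x; 1/2, 1/2) dx`: the image of
`Gamma(1/2, 1/2) ⊗ ρ` under multiplication. -/
def gammaMixture (ρ : Measure ℝ) : Measure ℝ :=
  ((gammaMeasure (1 / 2) (1 / 2)).prod ρ).map (fun q => q.1 * q.2)

lemma IsLevyMeasure.sigmaFinite {ρ : Measure ℝ} (hρ : IsLevyMeasure ρ) : SigmaFinite ρ := by
  have hfin : ∀ n : ℕ, ρ (Ioi (1 / ((n : ℝ) + 1))) < ∞ := by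
    intro n
    have hn : (0 : ℝ) < 1 / ((n : ℝ) + 1) := by positivity
    have hn1 : 1 / ((n : ℝ) + 1) ≤ 1 := by
      rw [div_le_one (by positivity)]
      linarith [(Nat.cast_nonneg n : (0 : ℝ) ≤ n)]
    have hmeas : Measurable (fun x : ℝ => ENNReal.ofReal (min 1 x)) := by fun_prop
    have hsub : Ioi (1 / ((n : ℝ) + 1)) ⊆
        {x | ENNReal.ofReal (1 / ((n : ℝ) + 1)) ≤ ENNReal.ofReal (min 1 x)} := fun x hx =>
      ENNReal.ofReal_le_ofReal (le_min hn1 (le_of_lt hx))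
    refine lt_of_le_of_lt ((measure_mono hsub).trans
      (meas_ge_le_lintegral_div hmeas.aemeasurable (by simpa using hn) ENNReal.ofReal_ne_top)) ?_
    exact ENNReal.div_lt_top hρ.lintegral_lt_top.ne (by simpa using hn)
  refine ⟨⟨⟨fun n => Iic 0 ∪ Ioi (1 / ((n : ℝ) + 1)), fun _ => trivial, fun n => ?_, ?_⟩⟩⟩
  · exact (measure_union_le _ _).trans_lt (by simpa [hρ.nonpos_null] using hfin n)
  · refine eq_univ_of_forall fun x => ?_
    rcases le_or_gt x 0 with hx | hx
    · exact mem_iUnion.2 ⟨0, Or.inl hx⟩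
    · obtain ⟨n, hn⟩ := exists_nat_one_div_lt hx
      exact mem_iUnion.2 ⟨n, Or.inr hn⟩

/-- The defining formula `ν(A) = ∫ ρ(A / x) Gamma(x; 1/2, 1/2) dx`, where
`A / x = {w : x w ∈ A}`. -/
lemma gammaMixture_apply {ρ : Measure ℝ} (hρ : IsLevyMeasure ρ) {A : Set ℝ}
    (hA : MeasurableSet A) :
    gammaMixture ρ A = ∫⁻ x, ρ {w | x * w ∈ A} ∂(gammaMeasure (1 / 2) (1 / 2)) := by
  have := hρ.sigmaFinite
  have hm : Measurable (fun q : ℝ × ℝ => q.1 * q.2) := by fun_prop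
  rw [gammaMixture, Measure.map_apply hm hA, Measure.prod_apply (hm hA)]
  rfl

/-! ## Order statistics and Poisson points -/

/-- The `k`-th largest (`k = 1, 2, …`) of `x 0, …, x (n-1)`, that is, the `k`-th entry of the
decreasing rearrangement of `x`; it is `0` for `k > n` (and for `k = 0`). -/
def orderStat {n : ℕ} (x : Fin n → ℝ) (k : ℕ) : ℝ :=
  if h : 1 ≤ k ∧ k ≤ n then
    x (Tuple.sort (fun j => -x j) ⟨k - 1, by omega⟩)
  else 0

/-- `G 1 < G 2 < …` are the ordered points of a rate one Poisson process on `(0, ∞)`: with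
`G 0 = 0`, the spacings `G (k+1) - G k` are independent with law `Exp(1)`. -/
structure IsUnitPoissonPoints {Ω : Type*} [MeasurableSpace Ω] (P : Measure Ω)
    (G : ℕ → Ω → ℝ) : Prop where
  start : G 0 =ᵐ[P] 0
  spacing_law : ∀ k, HasLaw (fun ω => G (k + 1) ω - G k ω) (expMeasure 1) P
  spacing_indep : iIndepFun (fun k ω => G (k + 1) ω - G k ω) P

/-- The function `y ↦ e^{-y} ∑_{i<k} y^i / i!`, the probability that a Poisson variable of mean `y`
is less than `k`. -/
def poissonSum (k : ℕ) (y : ℝ) : ℝ :=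
  Real.exp (-y) * ∑ i ∈ Finset.range k, y ^ i / (i.factorial : ℝ)

/-! ## The random feedforward network -/

/-- The widths of all layers: `din` at layer `0`, `p l` at the hidden layers `l = 1, …, L`, and
`dout` at layer `L + 1`. -/
def layerWidth (L din dout : ℕ) (p : ℕ → ℕ) (l : ℕ) : ℕ :=
  if l = 0 then din else if l ≤ L then p l else dout

/-- The labels of all random parameters of a network with layer widths `w`. For `l = 0, …, L`:
`nodeVar l j` is the variance parameter of node `j` at layer `l`, `weight l j k` is the Gaussian
factor of the weight from node `j` at layer `l` to node `k` at layer `l + 1`, and `bias l k` is the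
bias of node `k` at layer `l + 1`. -/
inductive ParamIndex (L : ℕ) (w : ℕ → ℕ) : Type
  | nodeVar (l : Fin (L + 1)) (j : Fin (w l))
  | weight (l : Fin (L + 1)) (j : Fin (w l)) (k : Fin (w (l + 1)))
  | bias (l : Fin (L + 1)) (k : Fin (w (l + 1)))

/-- The family of all random parameters, for layer widths `w`. -/
def paramFamily {Ω : Type*} (L : ℕ) (w : ℕ → ℕ) (lam : ℕ → (n : ℕ) → Fin n → Ω → ℝ)
    (V : ℕ → ℕ → ℕ → Ω → ℝ) (B : ℕ → ℕ → Ω → ℝ) : ParamIndex L w → Ω → ℝ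
  | .nodeVar l j => lam l (w l) j
  | .weight l j k => V (l + 1) j k
  | .bias l k => B (l + 1) k

/-- A feedforward network with `L` hidden layers of arbitrary widths, whose weights are scale
mixtures of Gaussians with per-node variances. Nodes are numbered from `0`. -/
structure ScaleMixtureNetwork {Ω : Type*} [MeasurableSpace Ω] (P : Measure Ω)
    (L din dout : ℕ) (σb σv : ℝ) where
  /-- the law of the per-node variances at hidden layer `l` when this layer has width `n` -/
  μ : ℕ → ℕ → Measure ℝ
  /-- `lam l n j`: the variance of node `j` at layer `l` when this layer has width `n` -/
  lam : ℕ → (n : ℕ) → Fin n → Ω → ℝ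
  /-- `V l j k`: the Gaussian factor of the weight from node `j` at layer `l - 1` to node `k` at
  layer `l` -/
  V : ℕ → ℕ → ℕ → Ω → ℝ
  /-- `B l k`: the bias of node `k` at layer `l` -/
  B : ℕ → ℕ → Ω → ℝ
  μ_neg_null : ∀ l n, 1 ≤ l → l ≤ L → 1 ≤ n → μ l n (Iio 0) = 0
  lam_zero : ∀ j ω, lam 0 din j ω = 1 / (din : ℝ)
  lam_law : ∀ l n (j : Fin n), 1 ≤ l → l ≤ L → 1 ≤ n → HasLaw (lam l n j) (μ l n) P
  V_law : ∀ p : ℕ → ℕ, (∀ l, 1 ≤ p l) → ∀ (l : Fin (L + 1))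
    (j : Fin (layerWidth L din dout p l)) (k : Fin (layerWidth L din dout p (l + 1))),
    HasLaw (V (l + 1) j k) (gaussianReal 0 (Real.toNNReal (σv ^ 2))) P
  B_law : ∀ p : ℕ → ℕ, (∀ l, 1 ≤ p l) → ∀ (l : Fin (L + 1))
    (k : Fin (layerWidth L din dout p (l + 1))),
    HasLaw (B (l + 1) k) (gaussianReal 0 (Real.toNNReal (σb ^ 2))) P
  indep : ∀ p : ℕ → ℕ, (∀ l, 1 ≤ p l) →
    iIndepFun (paramFamily L (layerWidth L din dout p) lam V B) P

/-- The weight `W = √λ · V` from node `j` at layer `l` (of width `n`) to node `m` at layer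
`l + 1`. -/
def ScaleMixtureNetwork.W {Ω : Type*} [MeasurableSpace Ω] {P : Measure Ω} {L din dout : ℕ}
    {σb σv : ℝ} (N : ScaleMixtureNetwork P L din dout σb σv) (l n : ℕ) (j : Fin n) (m : ℕ)
    (ω : Ω) : ℝ :=
  Real.sqrt (N.lam l n j ω) * N.V (l + 1) j m ω

end

noncomputable section

/-! ## Convergence of functionals from a separating multiplicative family -/

/-! The whole argument runs through the tails of the row law μ_n. The k-th largest of n variables
exceeds b ≥ 0 exactly when at least k of them do, so order statistics are functions of level counts,
and these counts become Poisson once n·μ_n((x, ∞)) → ρ((x, ∞)) at every non-atom x > 0 of ρ.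

From sums to tails (`tendsto_laplaceExponent`, `tendsto_tail_of_tendsto_laplaceExponent`). The
Laplace transform of a row sum is an n-th power, so n ∫ (1 - e^{-kx}) dμ_n converges to ka + ∫ (1 -
e^{-kw}) dρ for every integer k. Differences of these in k are the moments of n(1 - e^{-x}) μ_n(dx)
carried to [0, 1] by x ↦ e^{-x}. By Weierstrass these measures converge weakly; the drift becomes an
atom of mass a at the image of x = 0, invisible to tails away from 0.

From tails to order statistics (`tendstoInDistribution_orderStat`). Fix a countable dense set of
levels d_i that are not atoms of ρ, and encode a sequence by the numbers 2^{-N_i}, with N_i the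
number of its terms above d_i. Codes live in a compact cube, where mixed moments determine weak
convergence. For an array a mixed moment is (1 - c_n/n)^n, and the limit of c_n is read off the
tails. For the limit, the inverse tail at G_k exceeds d_i exactly when G_k lies below the tail at
d_i, almost surely, so the moment is an expected product over Poisson points; a martingale argument
evaluates it (`IsUnitPoissonPoints.integral_of_tendsto_prod`) and the two limits agree. Sequences
depend continuously on their codes (`exists_isOpen_levelCode`), which transfers the convergence
back.

For networks, W² = λV² with V² distributed as σ_v² times a Gamma(1/2, 1/2) variable. Tail
convergence survives multiplicative mixing by dominated convergence (`tendsto_tail_mulMixture`), so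
no limit theorem for the sum of the squared weights is needed. -/

theorem tendsto_functional_of_separating {K : Type*} [TopologicalSpace K] [CompactSpace K]
    (T : ℕ → C(K, ℝ) →ₗ[ℝ] ℝ) (T₀ : C(K, ℝ) →ₗ[ℝ] ℝ) (C : ℝ)
    (hT : ∀ᶠ n in atTop, ∀ f, |T n f| ≤ C * ‖f‖) (hT₀ : ∀ f, |T₀ f| ≤ C * ‖f‖)
    (S : Submonoid C(K, ℝ)) (hS : ∀ x y : K, x ≠ y → ∃ f ∈ S, f x ≠ f y)
    (h : ∀ f ∈ S, Tendsto (fun n => T n f) atTop (𝓝 (T₀ f))) (f : C(K, ℝ)) :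
    Tendsto (fun n => T n f) atTop (𝓝 (T₀ f)) := by
  -- The linear span of a submonoid is already the algebra it generates, so convergence extends from
  -- `S` to `A` by linearity. Stone–Weierstrass makes `A` dense, and the uniform bound closes an ε/3
  -- argument.
  set A := Algebra.adjoin ℝ (S : Set C(K, ℝ)) with hA
  have hAlim : ∀ g ∈ A, Tendsto (fun n => T n g) atTop (𝓝 (T₀ g)) := by
    intro g hg
    have hspan := Algebra.adjoin_eq_span ℝ (S : Set C(K, ℝ))
    rw [Submonoid.closure_eq] at hspan
    have hg' : g ∈ Submodule.span ℝ (S : Set C(K, ℝ)) := hspan ▸ hg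
    clear hg
    induction hg' using Submodule.span_induction with
    | mem x hx => exact h x hx
    | zero => simp
    | add x y _ _ hx hy => simpa using hx.add hy
    | smul c x _ hx => simpa using hx.const_mul c
  have hsep : A.SeparatesPoints := by
    intro x y hxy
    obtain ⟨g, hg, hgxy⟩ := hS x y hxy
    exact ⟨g, ⟨g, Algebra.subset_adjoin hg, rfl⟩, hgxy⟩
  have hfA : f ∈ A.topologicalClosure := by
    rw [ContinuousMap.subalgebra_topologicalClosure_eq_top_of_separatesPoints A hsep]
    trivial
  rw [Metric.tendsto_atTop']
  intro ε hε
  -- The sign of `C` is not known; `|C| + 1` keeps the denominator positive.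
  obtain ⟨g, hgA, hfg⟩ : ∃ g ∈ A, ‖f - g‖ < ε / (3 * (|C| + 1)) := by
    have := Metric.mem_closure_iff.1 hfA (ε / (3 * (|C| + 1))) (by positivity)
    simpa [dist_eq_norm] using this
  have hCfg : C * ‖f - g‖ ≤ ε / 3 := by
    have h1 : C * ‖f - g‖ ≤ (|C| + 1) * (ε / (3 * (|C| + 1))) := by
      refine mul_le_mul ?_ hfg.le (norm_nonneg _) (by positivity)
      linarith [le_abs_self C]
    have h2 : (|C| + 1) * (ε / (3 * (|C| + 1))) = ε / 3 := by field_simp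
    linarith
  have hg := Metric.tendsto_atTop'.1 (hAlim g hgA) (ε / 3) (by positivity)
  obtain ⟨N, hN⟩ := hg
  obtain ⟨M, hM⟩ := eventually_atTop.1 hT
  refine ⟨max N M, fun n hn => ?_⟩
  have h1 := hN n (lt_of_le_of_lt (le_max_left _ _) hn)
  have h2 := hM n ((le_max_right _ _).trans hn.le) (f - g)
  have h3 := hT₀ (f - g)
  rw [map_sub] at h2 h3
  rw [Real.dist_eq] at *
  rw [abs_lt] at *
  rw [abs_le] at h2 h3
  constructor <;> linarith [h1.1, h1.2, h2.1, h2.2, h3.1, h3.2]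

/-! ## One-sided continuity of tails -/

lemma IsLevyMeasure.levyTail_lt_top {ρ : Measure ℝ} (hρ : IsLevyMeasure ρ) {x : ℝ} (hx : 0 < x) :
    levyTail ρ x < ∞ := by
  have hm : (0 : ℝ) < min 1 x := lt_min one_pos hx
  have hmeas : Measurable (fun x : ℝ => ENNReal.ofReal (min 1 x)) := by fun_prop
  have hsub : Ioi x ⊆ {y | ENNReal.ofReal (min 1 x) ≤ ENNReal.ofReal (min 1 y)} := fun y hy =>
    ENNReal.ofReal_le_ofReal (min_le_min le_rfl (le_of_lt hy))
  refine lt_of_le_of_lt ((measure_mono hsub).trans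
    (meas_ge_le_lintegral_div hmeas.aemeasurable (by simpa using hm) ENNReal.ofReal_ne_top)) ?_
  exact ENNReal.div_lt_top hρ.lintegral_lt_top.ne (by simpa using hx)

lemma levyTail_antitone (ρ : Measure ℝ) : Antitone (levyTail ρ) := fun _ _ h =>
  measure_mono (Ioi_subset_Ioi h)

/-- Right-continuity of the tail, from continuity of the measure along an increasing union; it also
covers an infinite tail. -/
lemma exists_gt_levyTail_gt {ρ : Measure ℝ} {x : ℝ} {c : ℝ≥0∞} (hc : c < levyTail ρ x) :
    ∃ y, x < y ∧ c < levyTail ρ y := by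
  have hU : (⋃ n : ℕ, Ioi (x + 1 / ((n : ℝ) + 1))) = Ioi x := by
    ext y
    simp only [mem_iUnion, mem_Ioi]
    constructor
    · rintro ⟨n, hn⟩
      have : (0 : ℝ) < 1 / ((n : ℝ) + 1) := by positivity
      linarith
    · intro hy
      obtain ⟨n, hn⟩ := exists_nat_one_div_lt (sub_pos.2 hy)
      exact ⟨n, by linarith⟩
  have hmono : Monotone (fun n : ℕ => Ioi (x + 1 / ((n : ℝ) + 1))) := by
    intro m n hmn
    refine Ioi_subset_Ioi ?_
    have := Nat.one_div_le_one_div (α := ℝ) hmn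
    linarith
  have ht := tendsto_measure_iUnion_atTop (μ := ρ) hmono
  rw [hU] at ht
  obtain ⟨n, hn⟩ := (ht.eventually_const_lt hc).exists
  exact ⟨_, by have : (0 : ℝ) < 1 / ((n : ℝ) + 1) := by positivity
               linarith, hn⟩

/-- Left-continuity of the tail at a non-atom. Continuity from above needs a set of finite mass, so
the approximating points x - x/(n+2) are kept strictly positive. -/
lemma exists_lt_levyTail_lt {ρ : Measure ℝ} (hρ : IsLevyMeasure ρ) {x : ℝ} (hx : 0 < x)
    (hx0 : ρ {x} = 0) {c : ℝ≥0∞} (hc : levyTail ρ x < c) :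
    ∃ y, 0 < y ∧ y < x ∧ levyTail ρ y < c := by
  have hU : (⋂ n : ℕ, Ioi (x - x / ((n : ℝ) + 2))) = Ici x := by
    ext y
    simp only [mem_iInter, mem_Ioi, mem_Ici]
    constructor
    · intro h
      by_contra! hy
      obtain ⟨n, hn⟩ := exists_nat_one_div_lt (div_pos (sub_pos.2 hy) hx)
      have h1 := h n
      have h2 : x / ((n : ℝ) + 2) ≤ x * (1 / ((n : ℝ) + 1)) := by
        rw [div_eq_mul_one_div]
        gcongr
        linarith
      have h3 : x * (1 / ((n : ℝ) + 1)) < x - y := by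
        rw [lt_div_iff₀ hx] at hn
        linarith
      linarith
    · intro hy n
      have : (0 : ℝ) < x / ((n : ℝ) + 2) := by positivity
      linarith
  have hmono : Antitone (fun n : ℕ => Ioi (x - x / ((n : ℝ) + 2))) := by
    intro m n hmn
    refine Ioi_subset_Ioi ?_
    have : x / ((n : ℝ) + 2) ≤ x / ((m : ℝ) + 2) := by gcongr
    linarith
  have hpos : ∀ n : ℕ, 0 < x - x / ((n : ℝ) + 2) := by
    intro n
    rw [sub_pos, div_lt_iff₀ (by positivity)]
    nlinarith [(Nat.cast_nonneg n : (0 : ℝ) ≤ n)]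
  have ht := tendsto_measure_iInter_atTop (μ := ρ) (fun n => measurableSet_Ioi.nullMeasurableSet)
    hmono ⟨0, (hρ.levyTail_lt_top (hpos 0)).ne⟩
  rw [hU, ← Ioi_union_left, measure_union (by simp) (measurableSet_singleton _), hx0,
    add_zero] at ht
  obtain ⟨n, hn⟩ := (ht.eventually_lt_const hc).exists
  refine ⟨_, hpos n, ?_, hn⟩
  have : (0 : ℝ) < x / ((n : ℝ) + 2) := by positivity
  linarith

/-! ## From Laplace exponents to tails -/

/-- The map `y ↦ exp (-max y 0)` into the unit interval. -/
def expNegPart (y : ℝ) : unitInterval :=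
  ⟨Real.exp (-max y 0), (Real.exp_pos _).le, Real.exp_le_one_iff.2 (by simp)⟩

lemma continuous_expNegPart : Continuous expNegPart := by
  unfold expNegPart
  fun_prop

lemma expNegPart_of_nonneg {y : ℝ} (hy : 0 ≤ y) : (expNegPart y : ℝ) = Real.exp (-y) := by
  simp [expNegPart, hy]

lemma one_sub_exp_neg_le (y : ℝ) : 1 - Real.exp (-y) ≤ min 1 y := by
  refine le_min (by linarith [Real.exp_pos (-y)]) ?_
  linarith [Real.add_one_le_exp (-y)]

lemma IsLevyMeasure.integrable_min {ρ : Measure ℝ} (hρ : IsLevyMeasure ρ) :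
    Integrable (fun x : ℝ => min 1 x) ρ := by
  refine ⟨by fun_prop, ?_⟩
  rw [hasFiniteIntegral_iff_ofReal]
  · exact hρ.lintegral_lt_top
  · have : ∀ᵐ x ∂ρ, x ∉ Iic 0 := measure_eq_zero_iff_ae_notMem.1 hρ.nonpos_null
    filter_upwards [this] with x hx
    exact le_min zero_le_one (not_le.1 hx).le

lemma IsLevyMeasure.ae_pos {ρ : Measure ℝ} (hρ : IsLevyMeasure ρ) : ∀ᵐ x ∂ρ, 0 < x := by
  have : ∀ᵐ x ∂ρ, x ∉ Iic 0 := measure_eq_zero_iff_ae_notMem.1 hρ.nonpos_null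
  filter_upwards [this] with x hx using not_le.1 hx

/-- The functional `h ↦ ∫ h (e^{-y}) (1 - e^{-y}) m(dy)` on `C([0, 1])`. -/
def expFunctional (m : Measure ℝ) (hm : Integrable (fun y => 1 - (expNegPart y : ℝ)) m) :
    C(unitInterval, ℝ) →ₗ[ℝ] ℝ where
  toFun h := ∫ y, h (expNegPart y) * (1 - (expNegPart y : ℝ)) ∂m
  map_add' f g := by
    have hi : ∀ f : C(unitInterval, ℝ), Integrable
        (fun y => f (expNegPart y) * (1 - (expNegPart y : ℝ))) m := fun f => by
      refine hm.bdd_mul (c := ‖f‖) ?_ ?_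
      · exact (f.continuous.comp continuous_expNegPart).aestronglyMeasurable
      · exact Eventually.of_forall fun y => f.norm_coe_le_norm _
    simp only [ContinuousMap.add_apply, add_mul]
    exact integral_add (hi f) (hi g)
  map_smul' c f := by
    simp only [ContinuousMap.smul_apply, smul_eq_mul, mul_assoc, integral_const_mul,
      RingHom.id_apply]

lemma integrable_expFunctional {m : Measure ℝ}
    (hm : Integrable (fun y => 1 - (expNegPart y : ℝ)) m) (f : C(unitInterval, ℝ)) :
    Integrable (fun y => f (expNegPart y) * (1 - (expNegPart y : ℝ))) m := by
  refine hm.bdd_mul (c := ‖f‖) ?_ ?_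
  · exact (f.continuous.comp continuous_expNegPart).aestronglyMeasurable
  · exact Eventually.of_forall fun y => f.norm_coe_le_norm _

lemma abs_expFunctional_le {m : Measure ℝ}
    (hm : Integrable (fun y => 1 - (expNegPart y : ℝ)) m) (f : C(unitInterval, ℝ)) :
    |expFunctional m hm f| ≤ (∫ y, (1 - (expNegPart y : ℝ)) ∂m) * ‖f‖ := by
  rw [← integral_mul_const, ← Real.norm_eq_abs]
  refine norm_integral_le_of_norm_le (hm.mul_const _) (Eventually.of_forall fun y => ?_)
  have : 0 ≤ 1 - (expNegPart y : ℝ) := by linarith [(expNegPart y).2.2]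
  rw [norm_mul, mul_comm, Real.norm_of_nonneg this]
  exact mul_le_mul_of_nonneg_left (f.norm_coe_le_norm _) this

/-- A continuous function of `e^{-y}` which, after multiplication by `1 - e^{-y}`, separates
`(y, ∞)` from `(-∞, x]`. -/
lemma exists_expNegPart_separation {x y : ℝ} (hx : 0 < x) (hxy : x < y) :
    ∃ h : C(unitInterval, ℝ), h 1 = 0 ∧
      (∀ z, y < z → h (expNegPart z) * (1 - (expNegPart z : ℝ)) = 1) ∧
      (∀ z, z ≤ x → h (expNegPart z) * (1 - (expNegPart z : ℝ)) = 0) ∧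
      (∀ z, 0 ≤ h (expNegPart z) * (1 - (expNegPart z : ℝ))) ∧
      (∀ z, h (expNegPart z) * (1 - (expNegPart z : ℝ)) ≤ 1) := by
  set p := Real.exp (-x)
  set q := Real.exp (-y)
  have hqp : q < p := Real.exp_lt_exp.2 (by linarith)
  have hp1 : p < 1 := by
    rw [← Real.exp_zero]
    exact Real.exp_lt_exp.2 (by linarith)
  have hden : ∀ u : unitInterval, 0 < max (1 - (u : ℝ)) (1 - p) := fun u =>
    lt_max_of_lt_right (by linarith)
  -- A ramp in u = e^{-z}, equal to 1 for u ≤ q and to 0 for u ≥ p. Dividing it by 1 - u is harmless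
  -- since it vanishes near u = 1; the maximum with 1 - p only keeps the quotient continuous there.
  let c : ℝ → ℝ := fun u => max 0 (min 1 ((p - u) / (p - q)))
  have hc0 : ∀ u, 0 ≤ c u := fun u => le_max_left _ _
  have hc1 : ∀ u, c u ≤ 1 := fun u => max_le zero_le_one (min_le_left _ _)
  have hcp : ∀ u, p ≤ u → c u = 0 := fun u hu => by
    refine max_eq_left ((min_le_right _ _).trans ?_)
    exact div_nonpos_of_nonpos_of_nonneg (by linarith) (by linarith)
  have hcq : ∀ u, u ≤ q → c u = 1 := fun u hu => by
    have : 1 ≤ (p - u) / (p - q) := by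
      rw [le_div_iff₀ (by linarith)]
      linarith
    simp [c, min_eq_left this]
  have key : ∀ u : unitInterval,
      c u / max (1 - (u : ℝ)) (1 - p) * (1 - (u : ℝ)) = c u := fun u => by
    rcases le_total p u with h | h
    · simp [hcp _ h]
    · have h1 : max (1 - (u : ℝ)) (1 - p) = 1 - (u : ℝ) := max_eq_left (by linarith)
      have h2 := hden u
      rw [h1] at h2 ⊢
      exact div_mul_cancel₀ _ h2.ne'
  refine ⟨⟨fun u => c u / max (1 - (u : ℝ)) (1 - p), ?_⟩, ?_, ?_, ?_, ?_, ?_⟩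
  · refine Continuous.div ?_ (by fun_prop) (fun u => (hden u).ne')
    fun_prop
  · simp [hcp 1 hp1.le]
  · intro z hz
    simp only [ContinuousMap.coe_mk, key]
    refine hcq _ ?_
    rw [expNegPart_of_nonneg (by linarith)]
    exact Real.exp_le_exp.2 (by linarith)
  · intro z hz
    simp only [ContinuousMap.coe_mk, key]
    refine hcp _ ?_
    exact Real.exp_le_exp.2 (by linarith [max_le hz hx.le])
  · intro z
    simp only [ContinuousMap.coe_mk, key]
    exact hc0 _
  · intro z
    simp only [ContinuousMap.coe_mk, key]
    exact hc1 _

lemma integrable_one_sub_expNegPart {m : Measure ℝ} [IsFiniteMeasure m] :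
    Integrable (fun y => 1 - (expNegPart y : ℝ)) m := by
  refine Integrable.of_bound (C := 1) ?_ (Eventually.of_forall fun y => ?_)
  · have := continuous_expNegPart
    exact Continuous.aestronglyMeasurable (by fun_prop)
  · rw [Real.norm_of_nonneg (by linarith [(expNegPart y).2.2])]
    linarith [(expNegPart y).2.1]

lemma IsLevyMeasure.integrable_one_sub_expNegPart {ρ : Measure ℝ} (hρ : IsLevyMeasure ρ) :
    Integrable (fun y => 1 - (expNegPart y : ℝ)) ρ := by
  refine hρ.integrable_min.mono' ?_ ?_
  · have := continuous_expNegPart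
    exact Continuous.aestronglyMeasurable (by fun_prop)
  · filter_upwards [hρ.ae_pos] with y hy
    rw [Real.norm_of_nonneg (by linarith [(expNegPart y).2.2]), expNegPart_of_nonneg hy.le]
    exact one_sub_exp_neg_le y

lemma IsLevyMeasure.integrable_one_sub_exp {ρ : Measure ℝ} (hρ : IsLevyMeasure ρ) (k : ℕ) :
    Integrable (fun w => 1 - Real.exp (-(w * k))) ρ := by
  refine (hρ.integrable_min.const_mul (k + 1)).mono' (by fun_prop) ?_
  filter_upwards [hρ.ae_pos] with y hy
  have hyk : 0 ≤ y * k := by positivity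
  rw [Real.norm_of_nonneg (by linarith [Real.exp_le_one_iff.2 (neg_nonpos.2 hyk)])]
  refine (one_sub_exp_neg_le _).trans ?_
  have hk : (0 : ℝ) ≤ k := by positivity
  rcases le_total 1 y with h | h
  · rw [min_eq_left h]
    exact (min_le_left _ _).trans (by linarith)
  · rw [min_eq_right h]
    exact (min_le_right _ _).trans (by nlinarith)

/-- Convergence of the Laplace exponents `n ∫ (1 - e^{-kx}) μ_n(dx)` at all integers implies
convergence of the tails `n μ_n((x, ∞))` at all continuity points `x > 0`. -/
theorem tendsto_tail_of_tendsto_laplaceExponent {a : ℝ} (ha : 0 ≤ a) {ρ : Measure ℝ}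
    (hρ : IsLevyMeasure ρ) {μ : ℕ → Measure ℝ} (hμ : ∀ n, IsFiniteMeasure (μ n))
    (hμ0 : ∀ n, μ n (Iio 0) = 0)
    (h : ∀ k : ℕ, Tendsto (fun n : ℕ => n * ∫ x, (1 - Real.exp (-(x * k))) ∂(μ n)) atTop
      (𝓝 (k * a + ∫ w, (1 - Real.exp (-(w * k))) ∂ρ)))
    {x : ℝ} (hx : 0 < x) (hx0 : ρ {x} = 0) :
    Tendsto (fun n : ℕ => n * (μ n).real (Ioi x)) atTop (𝓝 (levyTail ρ x).toReal) := by
  have hμpos : ∀ n, ∀ᵐ y ∂(μ n), 0 ≤ y := fun n => by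
    have : ∀ᵐ y ∂(μ n), y ∉ Iio 0 := measure_eq_zero_iff_ae_notMem.1 (hμ0 n)
    filter_upwards [this] with y hy using not_lt.1 hy
  let T : ℕ → C(unitInterval, ℝ) →ₗ[ℝ] ℝ := fun n =>
    (n : ℝ) • expFunctional (μ n) integrable_one_sub_expNegPart
  let ev : C(unitInterval, ℝ) →ₗ[ℝ] ℝ :=
    { toFun := fun f => f 1, map_add' := fun _ _ => rfl, map_smul' := fun _ _ => rfl }
  -- The drift appears as a point mass `a` at u = 1, that is at y = 0, because (k+1)a - ka = a·1^k.
  let T₀ : C(unitInterval, ℝ) →ₗ[ℝ] ℝ :=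
    a • ev + expFunctional ρ hρ.integrable_one_sub_expNegPart
  -- moments
  let u : C(unitInterval, ℝ) := ⟨fun t => (t : ℝ), continuous_subtype_val⟩
  have hmom : ∀ k : ℕ, Tendsto (fun n => T n (u ^ k)) atTop (𝓝 (T₀ (u ^ k))) := by
    intro k
    -- With v = e^{-y}: v^k (1 - v) = (1 - v^{k+1}) - (1 - v^k), so moments are differences of
    -- consecutive Laplace exponents.
    have hexp : ∀ y : ℝ, 0 ≤ y → (expNegPart y : ℝ) ^ k * (1 - (expNegPart y : ℝ)) =
        (1 - Real.exp (-(y * (k + 1 : ℕ)))) - (1 - Real.exp (-(y * k))) := by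
      intro y hy
      rw [expNegPart_of_nonneg hy, ← Real.exp_nat_mul, mul_sub, mul_one, ← Real.exp_add]
      push_cast
      ring_nf
    have hint : ∀ n (k : ℕ), Integrable (fun w => 1 - Real.exp (-(w * k))) (μ n) := by
      intro n k
      refine Integrable.of_bound (C := 1) (by fun_prop) ?_
      filter_upwards [hμpos n] with y hy
      have hyk : 0 ≤ y * k := by positivity
      rw [Real.norm_of_nonneg (by linarith [Real.exp_le_one_iff.2 (neg_nonpos.2 hyk)])]
      linarith [Real.exp_pos (-(y * k))]
    have hTn : ∀ n, T n (u ^ k) = n * ∫ x, (1 - Real.exp (-(x * (k + 1 : ℕ)))) ∂(μ n)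
        - n * ∫ x, (1 - Real.exp (-(x * k))) ∂(μ n) := by
      intro n
      rw [← mul_sub, ← integral_sub (hint n _) (hint n _)]
      simp only [T, LinearMap.smul_apply, smul_eq_mul]
      congr 1
      refine integral_congr_ae ?_
      filter_upwards [hμpos n] with y hy using hexp y hy
    have hT0 : T₀ (u ^ k) = ((k + 1 : ℕ) * a + ∫ w, (1 - Real.exp (-(w * (k + 1 : ℕ)))) ∂ρ)
        - (k * a + ∫ w, (1 - Real.exp (-(w * k))) ∂ρ) := by
      have : ∫ y, (u ^ k) (expNegPart y) * (1 - (expNegPart y : ℝ)) ∂ρ =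
          ∫ w, (1 - Real.exp (-(w * (k + 1 : ℕ)))) ∂ρ - ∫ w, (1 - Real.exp (-(w * k))) ∂ρ := by
        rw [← integral_sub (hρ.integrable_one_sub_exp _) (hρ.integrable_one_sub_exp _)]
        refine integral_congr_ae ?_
        filter_upwards [hρ.ae_pos] with y hy using hexp y hy.le
      simp only [T₀, ev, expFunctional, LinearMap.add_apply, LinearMap.smul_apply,
        LinearMap.coe_mk, AddHom.coe_mk, this]
      simp [u]
      ring
    rw [hT0]
    simp only [hTn]
    exact (h (k + 1)).sub (h k)
  -- The zeroth moment bounds the norm of the positive functional `T n`; its convergence supplies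
  -- the uniform bound `C`.
  have hone : Tendsto (fun n : ℕ => n * ∫ y, (1 - (expNegPart y : ℝ)) ∂(μ n)) atTop
      (𝓝 (T₀ (u ^ 0))) := by
    refine (hmom 0).congr fun n => ?_
    simp [T, expFunctional]
  set C : ℝ := max (T₀ (u ^ 0) + 1) (a + ∫ y, (1 - (expNegPart y : ℝ)) ∂ρ)
  have hconv : ∀ f, Tendsto (fun n => T n f) atTop (𝓝 (T₀ f)) := by
    refine tendsto_functional_of_separating T T₀ C ?_ ?_ (Submonoid.powers u) ?_ ?_
    · filter_upwards [hone.eventually_lt_const (lt_add_one _)] with n hn f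
      simp only [T, LinearMap.smul_apply, smul_eq_mul, abs_mul, Nat.abs_cast]
      calc (n : ℝ) * |expFunctional (μ n) integrable_one_sub_expNegPart f|
          ≤ n * ((∫ y, (1 - (expNegPart y : ℝ)) ∂(μ n)) * ‖f‖) := by
            gcongr
            exact abs_expFunctional_le _ _
        _ = (n * ∫ y, (1 - (expNegPart y : ℝ)) ∂(μ n)) * ‖f‖ := by ring
        _ ≤ C * ‖f‖ := by
            gcongr
            exact hn.le.trans (le_max_left _ _)
    · intro f
      simp only [T₀, ev, LinearMap.add_apply, LinearMap.smul_apply, smul_eq_mul]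
      refine (abs_add_le _ _).trans ?_
      rw [abs_mul, abs_of_nonneg ha]
      have h1 : |f 1| ≤ ‖f‖ := f.norm_coe_le_norm 1
      have h2 := abs_expFunctional_le hρ.integrable_one_sub_expNegPart f
      calc a * |f 1| + |expFunctional ρ hρ.integrable_one_sub_expNegPart f|
          ≤ a * ‖f‖ + (∫ y, (1 - (expNegPart y : ℝ)) ∂ρ) * ‖f‖ := by gcongr
        _ = (a + ∫ y, (1 - (expNegPart y : ℝ)) ∂ρ) * ‖f‖ := by ring
        _ ≤ C * ‖f‖ := by
            gcongr
            exact le_max_right _ _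
    · intro s t hst
      exact ⟨u, Submonoid.mem_powers _, fun h => hst (Subtype.ext h)⟩
    · rintro _ ⟨k, rfl⟩
      exact hmom k
  -- The cutoffs vanish at u = 1, so the drift does not contribute, and both `T n f` and `T₀ f` are
  -- squeezed between tails at `s` and `t`.
  have hsand : ∀ s t, 0 < s → s < t → ∃ f : C(unitInterval, ℝ),
      (∀ n : ℕ, n * (μ n).real (Ioi t) ≤ T n f ∧ T n f ≤ n * (μ n).real (Ioi s)) ∧
      (levyTail ρ t).toReal ≤ T₀ f ∧ T₀ f ≤ (levyTail ρ s).toReal := by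
    intro s t hs hst
    obtain ⟨f, f1, ft, fs, f0, fle⟩ := exists_expNegPart_separation hs hst
    have main : ∀ (m : Measure ℝ) (hm : Integrable (fun y => 1 - (expNegPart y : ℝ)) m),
        m (Ioi s) < ∞ →
        m.real (Ioi t) ≤ expFunctional m hm f ∧ expFunctional m hm f ≤ m.real (Ioi s) := by
      intro m hm hfin
      have hfin' : m (Ioi t) < ∞ := (measure_mono (Ioi_subset_Ioi hst.le)).trans_lt hfin
      rw [← integral_indicator_one measurableSet_Ioi, ← integral_indicator_one measurableSet_Ioi]
      have hi : ∀ r, m (Ioi r) < ∞ → Integrable ((Ioi r).indicator (1 : ℝ → ℝ)) m := fun r hr =>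
        (integrable_indicator_iff measurableSet_Ioi).2 (integrableOn_const hr.ne)
      refine ⟨integral_mono (hi t hfin') (integrable_expFunctional hm f) fun z => ?_,
        integral_mono (integrable_expFunctional hm f) (hi s hfin) fun z => ?_⟩
      · by_cases hz : z ∈ Ioi t
        · simp only [indicator_of_mem hz, Pi.one_apply]
          exact (ft z hz).ge
        · simp only [indicator_of_notMem hz]
          exact f0 z
      · by_cases hz : z ∈ Ioi s
        · simp only [indicator_of_mem hz, Pi.one_apply]
          exact fle z
        · simp only [indicator_of_notMem hz]
          exact (fs z (not_lt.1 hz)).le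
    refine ⟨f, fun n => ?_, ?_⟩
    · obtain ⟨h1, h2⟩ := main (μ n) integrable_one_sub_expNegPart (measure_lt_top _ _)
      simp only [T, LinearMap.smul_apply, smul_eq_mul]
      exact ⟨by gcongr, by gcongr⟩
    · have h1 := main ρ hρ.integrable_one_sub_expNegPart (hρ.levyTail_lt_top hs)
      simpa [T₀, ev, f1, levyTail, measureReal_def] using h1
  have hxfin := (hρ.levyTail_lt_top hx).ne
  refine tendsto_order.2 ⟨fun c hc => ?_, fun c hc => ?_⟩
  · rcases lt_or_ge c 0 with hc0 | hc0
    · exact Eventually.of_forall fun n => hc0.trans_le (by positivity)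
    obtain ⟨y, hxy, hy⟩ := exists_gt_levyTail_gt
      ((ENNReal.ofReal_lt_iff_lt_toReal hc0 hxfin).2 hc)
    have hy' := (ENNReal.ofReal_lt_iff_lt_toReal hc0 (hρ.levyTail_lt_top (hx.trans hxy)).ne).1 hy
    obtain ⟨f, hf, hf1, -⟩ := hsand x y hx hxy
    filter_upwards [(hconv f).eventually_const_lt (hy'.trans_le hf1)] with n hn
    exact hn.trans_le (hf n).2
  · have hc0 : 0 ≤ c := ENNReal.toReal_nonneg.trans hc.le
    obtain ⟨y, hy0, hyx, hy⟩ := exists_lt_levyTail_lt hρ hx hx0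
      ((ENNReal.lt_ofReal_iff_toReal_lt hxfin).2 hc)
    have hy' := (ENNReal.lt_ofReal_iff_toReal_lt (hρ.levyTail_lt_top hy0).ne).1 hy
    obtain ⟨f, hf, -, hf1⟩ := hsand y x hy0 hyx
    filter_upwards [(hconv f).eventually_lt_const (hf1.trans_lt hy')] with n hn
    exact (hf n).1.trans_lt hn

/-! ## Laplace exponents of triangular arrays -/

/-- With y = -log φ, one has y/(1+y) ≤ 1 - φ ≤ y. Since n·y_n → c forces y_n → 0, both bounds times
n tend to c. -/
lemma tendsto_nat_mul_one_sub_of_tendsto_pow {φ : ℕ → ℝ} (hφ0 : ∀ n, 0 < φ n)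
    (hφ1 : ∀ n, φ n ≤ 1) {c : ℝ} (h : Tendsto (fun n => φ n ^ n) atTop (𝓝 (Real.exp (-c)))) :
    Tendsto (fun n : ℕ => n * (1 - φ n)) atTop (𝓝 c) := by
  have hlog : Tendsto (fun n : ℕ => (n : ℝ) * (-Real.log (φ n))) atTop (𝓝 c) := by
    have := ((Real.continuousAt_log (Real.exp_pos (-c)).ne').tendsto.comp h).neg
    rw [Real.log_exp, neg_neg] at this
    refine this.congr fun n => ?_
    simp [Real.log_pow]
  have hy0 : ∀ n, 0 ≤ -Real.log (φ n) := fun n => by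
    linarith [Real.log_nonpos (hφ0 n).le (hφ1 n)]
  have hy : Tendsto (fun n : ℕ => -Real.log (φ n)) atTop (𝓝 0) := by
    have := hlog.mul (tendsto_inv_atTop_nhds_zero_nat (𝕜 := ℝ))
    rw [mul_zero] at this
    refine this.congr' ?_
    filter_upwards [eventually_gt_atTop 0] with n hn
    have : (n : ℝ) ≠ 0 := by positivity
    field_simp
  have hlow : Tendsto (fun n : ℕ => (n : ℝ) * (-Real.log (φ n)) / (1 + -Real.log (φ n))) atTop
      (𝓝 c) := by
    have := hlog.div (hy.const_add 1) (by norm_num)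
    rwa [add_zero, div_one] at this
  refine tendsto_of_tendsto_of_tendsto_of_le_of_le hlow hlog (fun n => ?_) (fun n => ?_)
  · have h1 : φ n ≤ 1 / (1 + -Real.log (φ n)) := by
      have h2 := Real.add_one_le_exp (-Real.log (φ n))
      rw [Real.exp_neg, Real.exp_log (hφ0 n)] at h2
      rw [le_div_iff₀ (by linarith [hy0 n])]
      calc φ n * (1 + -Real.log (φ n)) ≤ φ n * (φ n)⁻¹ := by
            gcongr
            · exact (hφ0 n).le
            · linarith
        _ = 1 := mul_inv_cancel₀ (hφ0 n).ne'
    have h3 : -Real.log (φ n) / (1 + -Real.log (φ n)) ≤ 1 - φ n := by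
      have : -Real.log (φ n) / (1 + -Real.log (φ n)) = 1 - 1 / (1 + -Real.log (φ n)) := by
        have : (1 + -Real.log (φ n)) ≠ 0 := by linarith [hy0 n]
        field_simp
        ring
      linarith
    simp only [mul_div_assoc]
    gcongr
  · have := Real.log_le_sub_one_of_pos (hφ0 n)
    show (n : ℝ) * (1 - φ n) ≤ n * (-Real.log (φ n))
    gcongr
    linarith

section Array

variable {Ω : Type*} [MeasurableSpace Ω] {P : Measure Ω} [IsProbabilityMeasure P]

theorem tendsto_laplaceExponent {a : ℝ} {ρ : Measure ℝ} {X : (n : ℕ) → Fin n → Ω → ℝ}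
    {μ : ℕ → Measure ℝ} (hμ : ∀ n, IsProbabilityMeasure (μ n))
    (hX : ∀ n j, HasLaw (X n j) (μ n) P) (hind : ∀ n, iIndepFun (X n) P)
    (hμ0 : ∀ n, μ n (Iio 0) = 0)
    (hlim : TendstoID P (fun n ω => ∑ j, X n j ω) a ρ) (k : ℕ) :
    Tendsto (fun n : ℕ => n * ∫ x, (1 - Real.exp (-(x * k))) ∂(μ n)) atTop
      (𝓝 (k * a + ∫ w, (1 - Real.exp (-(w * k))) ∂ρ)) := by
  obtain ⟨κ, hκ, hconv⟩ := hlim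
  have hμpos : ∀ n, ∀ᵐ y ∂(μ n), 0 ≤ y := fun n => by
    have : ∀ᵐ y ∂(μ n), y ∉ Iio 0 := measure_eq_zero_iff_ae_notMem.1 (hμ0 n)
    filter_upwards [this] with y hy using not_lt.1 hy
  have hXpos : ∀ n, ∀ᵐ ω ∂P, ∀ j, 0 ≤ X n j ω := fun n => by
    refine ae_all_iff.2 fun j => ?_
    exact ((hX n j).ae_iff (p := fun y => 0 ≤ y) (measurableSet_setOfPred.1 measurableSet_Ici)).2
      (hμpos n)
  have hint : ∀ n, Integrable (fun x => Real.exp (-(x * k))) (μ n) := fun n => by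
    refine Integrable.of_bound (C := 1) (by fun_prop) ?_
    filter_upwards [hμpos n] with y hy
    rw [Real.norm_of_nonneg (Real.exp_pos _).le, Real.exp_le_one_iff, neg_nonpos]
    positivity
  have hφ0 : ∀ n, 0 < ∫ x, Real.exp (-(x * k)) ∂(μ n) := fun n => integral_exp_pos (hint n)
  have hφ1 : ∀ n, ∫ x, Real.exp (-(x * k)) ∂(μ n) ≤ 1 := fun n => by
    have : ∫ x, Real.exp (-(x * k)) ∂(μ n) ≤ ∫ x, (1 : ℝ) ∂(μ n) := by
      refine integral_mono_ae (hint n) (integrable_const _) ?_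
      filter_upwards [hμpos n] with y hy
      rw [Real.exp_le_one_iff, neg_nonpos]
      positivity
    simpa using this
  have key : Tendsto (fun n : ℕ => (∫ x, Real.exp (-(x * k)) ∂(μ n)) ^ n) atTop
      (𝓝 (Real.exp (-(k * a + ∫ w, (1 - Real.exp (-(w * k))) ∂ρ)))) := by
    -- Truncating at 0 makes the exponential bounded on all of ℝ without changing it on the support
    -- of the laws involved.
    let f : BoundedContinuousFunction ℝ ℝ := BoundedContinuousFunction.ofNormedAddCommGroup
      (fun x => Real.exp (-(max x 0 * k))) (by fun_prop) 1 (fun x => by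
        rw [Real.norm_of_nonneg (Real.exp_pos _).le, Real.exp_le_one_iff, neg_nonpos]
        positivity)
    have h1 := ProbabilityMeasure.tendsto_iff_forall_integral_tendsto.1 hconv.tendsto f
    have h2 : ∫ x, f x ∂((κ : Measure ℝ).map id) =
        Real.exp (-(k * a + ∫ w, (1 - Real.exp (-(w * k))) ∂ρ)) := by
      rw [Measure.map_id, neg_add, ← sub_eq_add_neg, ← hκ.laplace k (Nat.cast_nonneg k)]
      refine integral_congr_ae ?_
      have : ∀ᵐ y ∂(κ : Measure ℝ), y ∉ Iio 0 := measure_eq_zero_iff_ae_notMem.1 hκ.neg_null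
      filter_upwards [this] with y hy
      have hy' : 0 ≤ y := not_lt.1 hy
      simp [f, max_eq_left hy', mul_comm]
    simp only [ProbabilityMeasure.coe_mk] at h1
    rw [h2] at h1
    refine h1.congr fun n => ?_
    rw [integral_map (hconv.forall_aemeasurable n) f.continuous.aestronglyMeasurable]
    have h3 : ∀ᵐ ω ∂P, f (∑ j, X n j ω) = ∏ j, Real.exp (-(X n j ω * k)) := by
      filter_upwards [hXpos n] with ω hω
      have : 0 ≤ ∑ j, X n j ω := Finset.sum_nonneg fun j _ => hω j
      rw [← Real.exp_sum]
      simp [f, max_eq_left this, Finset.sum_mul]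
    rw [integral_congr_ae h3, (hind n).integral_fun_prod_comp
      (f := fun _ x => Real.exp (-(x * k))) (fun j => (hX n j).aemeasurable)
      (fun j => by fun_prop)]
    have h4 : ∀ j, ∫ ω, Real.exp (-(X n j ω * k)) ∂P = ∫ x, Real.exp (-(x * k)) ∂(μ n) := by
      intro j
      rw [← (hX n j).map_eq, integral_map (hX n j).aemeasurable (by fun_prop)]
    simp [h4]
  refine (tendsto_nat_mul_one_sub_of_tendsto_pow hφ0 hφ1 key).congr fun n => ?_
  rw [integral_sub (integrable_const _) (hint n)]
  simp

end Array

/-! ## Order statistics -/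

/-- Sorting by `-x` lists the values in decreasing order. There the entry at position k - 1 exceeds
b iff more than k - 1 entries do, and a permutation preserves the count. -/
lemma lt_orderStat_iff_of_le {n : ℕ} (x : Fin n → ℝ) {k : ℕ} (hk : 1 ≤ k) (hkn : k ≤ n) (b : ℝ) :
    b < orderStat x k ↔ k ≤ Finset.card {j | b < x j} := by
  rw [orderStat, dif_pos ⟨hk, hkn⟩]
  have hanti : Antitone (x ∘ Tuple.sort (fun j => -x j)) := by
    intro i j hij
    have := Tuple.monotone_sort (fun j => -x j) hij
    simpa using this
  have h1 := Tuple.lt_card_gt_iff_apply_gt_of_antitone (j := ⟨k - 1, by omega⟩) (a := b) hanti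
  rw [show b < x (Tuple.sort (fun j => -x j) ⟨k - 1, by omega⟩) ↔ _ from h1.symm]
  have h2 : Finset.card {i | b < (x ∘ Tuple.sort (fun j => -x j)) i} =
      Finset.card {j | b < x j} := by
    refine Finset.card_bij (fun i _ => Tuple.sort (fun j => -x j) i) ?_ ?_ ?_
    · simp
    · simp
    · intro j hj
      exact ⟨(Tuple.sort (fun j => -x j)).symm j, by simpa using hj, by simp⟩
  rw [h2]
  simp only
  omega

/-- For k > n the order statistic is 0 by convention, so the equivalence persists only for b ≥ 0. -/
lemma lt_orderStat_iff {n : ℕ} (x : Fin n → ℝ) {k : ℕ} (hk : 1 ≤ k) {b : ℝ} (hb : 0 ≤ b) :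
    b < orderStat x k ↔ k ≤ Finset.card {j | b < x j} := by
  by_cases h : k ≤ n
  · exact lt_orderStat_iff_of_le x hk h b
  · rw [orderStat, dif_neg (by tauto)]
    have : Finset.card {j | b < x j} ≤ n := (Finset.card_le_univ _).trans (by simp)
    constructor
    · intro h'
      linarith
    · intro h'
      omega

lemma orderStat_nonneg {n : ℕ} {x : Fin n → ℝ} (hx : ∀ j, 0 ≤ x j) (k : ℕ) :
    0 ≤ orderStat x k := by
  unfold orderStat
  split_ifs
  · exact hx _
  · exact le_rfl

lemma measurable_card_lt {n : ℕ} (b : ℝ) :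
    Measurable (fun x : Fin n → ℝ => Finset.card {j | b < x j}) := by
  simp_rw [Finset.card_filter]
  refine Finset.measurable_sum _ fun j _ => ?_
  exact Measurable.ite (measurableSet_lt measurable_const (measurable_pi_apply j))
    measurable_const measurable_const

lemma measurable_orderStat {n : ℕ} (k : ℕ) :
    Measurable (fun x : Fin n → ℝ => orderStat x k) := by
  by_cases h : 1 ≤ k ∧ k ≤ n
  · refine measurable_of_Ioi fun b => ?_
    have : (fun x : Fin n → ℝ => orderStat x k) ⁻¹' Ioi b =
        {x | k ≤ Finset.card {j | b < x j}} := by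
      ext x
      exact lt_orderStat_iff_of_le x h.1 h.2 b
    rw [this]
    exact measurableSet_le measurable_const (measurable_card_lt b)
  · simp only [orderStat, dif_neg h]
    exact measurable_const

/-! ## The inverse tail -/

lemma IsLevyMeasure.tendsto_levyTail {ρ : Measure ℝ} (hρ : IsLevyMeasure ρ) :
    Tendsto (levyTail ρ) atTop (𝓝 0) := by
  have hI : (⋂ r : ℝ, Ioi r) = ∅ := by
    refine eq_empty_of_forall_notMem fun x hx => ?_
    exact lt_irrefl x (mem_iInter.1 hx x)
  have := tendsto_measure_iInter_atTop (μ := ρ) (s := fun r : ℝ => Ioi r)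
    (fun r => measurableSet_Ioi.nullMeasurableSet) (fun _ _ h => Ioi_subset_Ioi h)
    ⟨1, (hρ.levyTail_lt_top one_pos).ne⟩
  rwa [hI, measure_empty] at this

lemma IsLevyMeasure.invLevyTail_set_nonempty {ρ : Measure ℝ} (hρ : IsLevyMeasure ρ) {u : ℝ}
    (hu : 0 < u) : {x : ℝ | 0 < x ∧ levyTail ρ x < ENNReal.ofReal u}.Nonempty := by
  have h := hρ.tendsto_levyTail.eventually_lt_const (ENNReal.ofReal_pos.2 hu)
  obtain ⟨x, hx, hx0⟩ := (h.and (eventually_gt_atTop 0)).exists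
  exact ⟨x, hx0, hx⟩

lemma bddBelow_invLevyTail_set (ρ : Measure ℝ) (u : ℝ) :
    BddBelow {x : ℝ | 0 < x ∧ levyTail ρ x < ENNReal.ofReal u} :=
  ⟨0, fun _ hx => hx.1.le⟩

lemma invLevyTail_nonneg (ρ : Measure ℝ) (u : ℝ) : 0 ≤ invLevyTail ρ u :=
  Real.sInf_nonneg fun _ hx => hx.1.le

lemma invLevyTail_of_nonpos (ρ : Measure ℝ) {u : ℝ} (hu : u ≤ 0) : invLevyTail ρ u = 0 := by
  simp [invLevyTail, ENNReal.ofReal_of_nonpos hu]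

lemma invLevyTail_le {ρ : Measure ℝ} {b u : ℝ} (hb : 0 ≤ b)
    (h : levyTail ρ b < ENNReal.ofReal u) : invLevyTail ρ u ≤ b := by
  refine le_of_forall_gt_imp_ge_of_dense fun x hx => ?_
  exact csInf_le (bddBelow_invLevyTail_set ρ u)
    ⟨hb.trans_lt hx, (levyTail_antitone ρ hx.le).trans_lt h⟩

lemma lt_invLevyTail {ρ : Measure ℝ} (hρ : IsLevyMeasure ρ) {b u : ℝ} (hu : 0 < u)
    (h : ENNReal.ofReal u < levyTail ρ b) : b < invLevyTail ρ u := by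
  obtain ⟨y, hby, hy⟩ := exists_gt_levyTail_gt h
  refine hby.trans_le (le_csInf (hρ.invLevyTail_set_nonempty hu) fun x hx => ?_)
  by_contra! hxy
  exact absurd ((levyTail_antitone ρ hxy.le).trans_lt hx.2) (not_lt.2 hy.le)

lemma invLevyTail_antitoneOn {ρ : Measure ℝ} (hρ : IsLevyMeasure ρ) :
    AntitoneOn (invLevyTail ρ) (Ioi 0) := fun _ hu _ _ huv =>
  csInf_le_csInf (bddBelow_invLevyTail_set ρ _) (hρ.invLevyTail_set_nonempty hu)
    fun _ hx => ⟨hx.1, hx.2.trans_le (ENNReal.ofReal_le_ofReal huv)⟩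

/-- Monotonicity holds only on (0, ∞): for u ≤ 0 the defining set is empty and the infimum takes the
default value 0. The superlevel sets are nevertheless intervals. -/
lemma measurable_invLevyTail {ρ : Measure ℝ} (hρ : IsLevyMeasure ρ) :
    Measurable (invLevyTail ρ) := by
  refine measurable_of_Ioi fun b => ?_
  rcases lt_or_ge b 0 with hb | hb
  · convert! MeasurableSet.univ
    exact eq_univ_of_forall fun u => hb.trans_le (invLevyTail_nonneg ρ u)
  · refine Set.OrdConnected.measurableSet ⟨fun u hu v hv w hw => ?_⟩
    have hpos : ∀ u, b < invLevyTail ρ u → 0 < u := fun u hu => by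
      by_contra! h
      rw [invLevyTail_of_nonpos ρ h] at hu
      linarith
    have hu0 := hpos u hu
    exact (mem_Ioi.1 hv).trans_le
      (invLevyTail_antitoneOn hρ (hu0.trans_le hw.1) (hpos v hv) hw.2)

/-- The excluded value of u is ambiguous: if u is the tail at b, the answer depends on whether the
tail is flat just to the right of b. A Gamma variable avoids this value almost surely. -/
lemma invLevyTail_gt_iff {ρ : Measure ℝ} (hρ : IsLevyMeasure ρ) {b u : ℝ} (hb : 0 ≤ b)
    (hu : 0 < u) (hfin : levyTail ρ b ≠ ∞) (hne : u ≠ (levyTail ρ b).toReal) :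
    b < invLevyTail ρ u ↔ u < (levyTail ρ b).toReal := by
  constructor
  · intro h
    by_contra! hcon
    have h1 : (levyTail ρ b).toReal < u := lt_of_le_of_ne hcon (Ne.symm hne)
    exact absurd (invLevyTail_le hb ((ENNReal.lt_ofReal_iff_toReal_lt hfin).2 h1)) (not_le.2 h)
  · intro h
    exact lt_invLevyTail hρ hu ((ENNReal.ofReal_lt_iff_lt_toReal hu.le hfin).2 h)

/-! ## Gamma laws -/

lemma gammaMeasure_Iio_zero (a r : ℝ) : gammaMeasure a r (Iio 0) = 0 := by
  rw [gammaMeasure, withDensity_apply _ measurableSet_Iio]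
  exact lintegral_gammaPDF_of_nonpos le_rfl

lemma gammaMeasure_singleton (a r x : ℝ) : gammaMeasure a r {x} = 0 :=
  withDensity_absolutelyContinuous _ _ (by simp)

lemma gammaMeasure_Iic_zero (a r : ℝ) : gammaMeasure a r (Iic 0) = 0 := by
  rw [← Iio_union_right, measure_union_null_iff]
  exact ⟨gammaMeasure_Iio_zero a r, gammaMeasure_singleton a r 0⟩

lemma gammaMeasure_ae_pos (a r : ℝ) : ∀ᵐ x ∂(gammaMeasure a r), 0 < x := by
  have : ∀ᵐ x ∂(gammaMeasure a r), x ∉ Iic 0 :=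
    measure_eq_zero_iff_ae_notMem.1 (gammaMeasure_Iic_zero a r)
  filter_upwards [this] with x hx using not_le.1 hx

/-- The derivative telescopes; on [0, ∞) what remains is minus the Gamma(k+1, 1) density. -/
lemma hasDerivAt_poissonSum_succ (k : ℕ) (y : ℝ) :
    HasDerivAt (poissonSum (k + 1)) (-(Real.exp (-y) * (y ^ k / (k.factorial : ℝ)))) y := by
  induction k with
  | zero =>
    have : poissonSum 1 = fun y => Real.exp (-y) := by
      ext y
      simp [poissonSum]
    rw [this]
    simpa using (hasDerivAt_neg y).exp
  | succ k ih =>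
    have : poissonSum (k + 1 + 1) = fun y => poissonSum (k + 1) y +
        Real.exp (-y) * (y ^ (k + 1) / ((k + 1).factorial : ℝ)) := by
      ext y
      simp only [poissonSum]
      rw [Finset.sum_range_succ _ (k + 1), mul_add]
    rw [this]
    have h2 := ((hasDerivAt_neg y).exp).mul ((hasDerivAt_pow (k + 1) y).div_const
      ((k + 1).factorial : ℝ))
    refine (ih.add h2).congr_deriv ?_
    have h3 : ((k + 1).factorial : ℝ) = (k + 1) * k.factorial := by
      rw [Nat.factorial_succ]
      push_cast
      ring
    have h4 : (k.factorial : ℝ) ≠ 0 := by positivity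
    have h5 : (k + 1 : ℝ) ≠ 0 := by positivity
    rw [h3]
    simp only [Nat.add_sub_cancel]
    push_cast
    field_simp
    ring

lemma tendsto_poissonSum (k : ℕ) : Tendsto (poissonSum k) atTop (𝓝 0) := by
  have : poissonSum k = fun y => ∑ i ∈ Finset.range k,
      (y ^ i * Real.exp (-y)) / (i.factorial : ℝ) := by
    ext y
    rw [poissonSum, Finset.mul_sum]
    refine Finset.sum_congr rfl fun i _ => ?_
    ring
  rw [this]
  have h : ∀ i ∈ Finset.range k, Tendsto (fun y : ℝ => (y ^ i * Real.exp (-y)) /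
      (i.factorial : ℝ)) atTop (𝓝 0) := fun i _ => by
    simpa using (Real.tendsto_pow_mul_exp_neg_atTop_nhds_zero i).div_const _
  simpa using tendsto_finsetSum _ h

lemma gammaMeasure_real_Ioi {k : ℕ} (hk : 1 ≤ k) {y : ℝ} (hy : 0 ≤ y) :
    (gammaMeasure k 1).real (Ioi y) = poissonSum k y := by
  obtain ⟨k, rfl⟩ := Nat.exists_eq_add_of_le' hk
  have hnn : ∀ x, 0 ≤ gammaPDFReal ((k + 1 : ℕ) : ℝ) 1 x := fun x =>
    gammaPDFReal_nonneg (by positivity) one_pos x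
  rw [measureReal_def, gammaMeasure, withDensity_apply _ measurableSet_Ioi]
  simp only [gammaPDF]
  rw [← integral_eq_lintegral_of_nonneg_ae (Eventually.of_forall hnn) (by fun_prop)]
  have h1 : ∫ x in Ioi y, gammaPDFReal ((k + 1 : ℕ) : ℝ) 1 x =
      ∫ x in Ioi y, -(-(Real.exp (-x) * (x ^ k / (k.factorial : ℝ)))) := by
    refine setIntegral_congr_fun measurableSet_Ioi fun x hx => ?_
    have hx0 : 0 ≤ x := hy.trans (le_of_lt hx)
    simp only [gammaPDFReal, if_pos hx0, Real.one_rpow, one_mul, neg_neg]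
    rw [Nat.cast_add, Nat.cast_one, add_sub_cancel_right, Real.rpow_natCast,
      Real.Gamma_nat_eq_factorial]
    ring
  rw [h1, integral_neg]
  have h2 := integral_Ioi_of_hasDerivAt_of_nonpos' (a := y) (g := poissonSum (k + 1)) (l := 0)
    (fun x _ => hasDerivAt_poissonSum_succ k x) (fun x hx => by
      have hx0 : 0 ≤ x := hy.trans (le_of_lt hx)
      have : 0 ≤ Real.exp (-x) * (x ^ k / (k.factorial : ℝ)) := by positivity
      linarith) (tendsto_poissonSum _)
  rw [h2]
  ring

/-- The exponential factors combine to a constant in the integration variable, so with one shape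
equal to 1 the convolution reduces to ∫_0^x y^{a-1} dy = x^a / a. -/
lemma gammaMeasure_conv_one {a r : ℝ} (ha : 0 < a) (hr : 0 < r) :
    (gammaMeasure a r).conv (gammaMeasure 1 r) = gammaMeasure (a + 1) r := by
  have hm : ∀ a, Measurable (gammaPDF a r) := fun a =>
    (measurable_gammaPDFReal a r).ennreal_ofReal
  rw [gammaMeasure, gammaMeasure, gammaMeasure, conv_withDensity_eq_lconvolution (hm _) (hm _)]
  congr 1
  ext x
  rw [lconvolution_def]
  rcases lt_or_ge x 0 with hx | hx
  · rw [gammaPDF_of_neg hx]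
    refine (lintegral_congr fun y => ?_).trans lintegral_zero
    rcases lt_or_ge y 0 with hy | hy
    · simp [gammaPDF_of_neg hy]
    · rw [gammaPDF_of_neg (x := -y + x) (by linarith), mul_zero]
  · have h1 : ∀ y, gammaPDF a r y * gammaPDF 1 r (-y + x) = (Icc 0 x).indicator (fun y =>
        ENNReal.ofReal ((r ^ (a + 1) / Real.Gamma a * Real.exp (-(r * x))) * y ^ (a - 1))) y := by
      intro y
      by_cases hy : y ∈ Icc 0 x
      · rw [indicator_of_mem hy, gammaPDF_of_nonneg hy.1, gammaPDF_of_nonneg (by linarith [hy.2]),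
          ← ENNReal.ofReal_mul (by have := Real.Gamma_pos_of_pos ha; have := hy.1; positivity)]
        congr 1
        rw [Real.Gamma_one, sub_self, Real.rpow_zero, Real.rpow_one, Real.rpow_add hr,
          Real.rpow_one, show -(r * x) = -(r * y) + -(r * (-y + x)) by ring, Real.exp_add]
        ring
      · rw [indicator_of_notMem hy]
        rcases lt_or_ge y 0 with hy0 | hy0
        · simp [gammaPDF_of_neg hy0]
        · have : x < y := by
            by_contra! h
            exact hy ⟨hy0, h⟩
          rw [gammaPDF_of_neg (x := -y + x) (by linarith), mul_zero]
    simp_rw [h1]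
    rw [lintegral_indicator measurableSet_Icc, gammaPDF_of_nonneg hx,
      ← ofReal_integral_eq_lintegral_ofReal]
    · congr 1
      rw [integral_const_mul, integral_Icc_eq_integral_Ioc,
        ← intervalIntegral.integral_of_le hx, integral_rpow (Or.inl (by linarith)),
        sub_add_cancel, Real.zero_rpow ha.ne', Real.Gamma_add_one ha.ne', add_sub_cancel_right]
      have := (Real.Gamma_pos_of_pos ha).ne'
      field_simp
      ring
    · have : IntervalIntegrable (fun y : ℝ => y ^ (a - 1)) volume 0 x :=
        intervalIntegral.intervalIntegrable_rpow' (by linarith)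
      exact (((intervalIntegrable_iff_integrableOn_Icc_of_le hx).1 this).const_mul _)
    · refine (ae_restrict_iff' measurableSet_Icc).2 (Eventually.of_forall fun y hy => ?_)
      have := Real.Gamma_pos_of_pos ha
      have := Real.rpow_nonneg hy.1 (a - 1)
      show 0 ≤ _
      positivity

/-! ## Unit rate Poisson points -/

lemma tendsto_poissonSum_nat (y : ℝ) : Tendsto (fun k => poissonSum k y) atTop (𝓝 1) := by
  have h := (NormedSpace.expSeries_div_hasSum_exp y).tendsto_sum_nat.const_mul (Real.exp (-y))
  rw [← Real.exp_eq_exp_ℝ, ← Real.exp_add, neg_add_cancel, Real.exp_zero] at h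
  exact h

namespace IsUnitPoissonPoints

variable {Ω : Type*} [MeasurableSpace Ω] {P : Measure Ω} {G : ℕ → Ω → ℝ}

lemma aemeasurable (hG : IsUnitPoissonPoints P G) (k : ℕ) : AEMeasurable (G k) P := by
  induction k with
  | zero => exact aemeasurable_const.congr hG.start.symm
  | succ k ih =>
    have := ih.add (hG.spacing_law k).aemeasurable
    refine this.congr (Eventually.of_forall fun ω => ?_)
    simp

lemma ae_eq_sum (hG : IsUnitPoissonPoints P G) :
    ∀ᵐ ω ∂P, ∀ k, G k ω = ∑ i ∈ Finset.range k, (G (i + 1) ω - G i ω) := by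
  filter_upwards [hG.start] with ω hω k
  rw [Finset.sum_range_sub (fun i => G i ω), hω]
  simp

lemma indepFun_spacing (hG : IsUnitPoissonPoints P G) (m : ℕ) {β : Type*} [MeasurableSpace β]
    {f : (Finset.range m → ℝ) → β} (hf : Measurable f) :
    IndepFun (fun ω => f (fun i => G (i + 1) ω - G i ω)) (fun ω => G (m + 1) ω - G m ω) P := by
  have h := hG.spacing_indep.indepFun_finset₀ (Finset.range m) {m} (by simp)
    (fun i => (hG.spacing_law i).aemeasurable)
  exact h.comp (φ := f) (ψ := fun v : (({m} : Finset ℕ) → ℝ) => v ⟨m, by simp⟩) hf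
    (measurable_pi_apply _)

lemma ae_monotone (hG : IsUnitPoissonPoints P G) : ∀ᵐ ω ∂P, Monotone (fun k => G k ω) := by
  have h : ∀ᵐ ω ∂P, ∀ k, 0 < G (k + 1) ω - G k ω := ae_all_iff.2 fun k =>
    ((hG.spacing_law k).ae_iff (p := fun y => 0 < y) (measurableSet_setOfPred.1 measurableSet_Ioi)).2
      (gammaMeasure_ae_pos 1 1)
  filter_upwards [h] with ω hω
  exact monotone_nat_of_le_succ fun k => by linarith [hω k]

theorem hasLaw_gamma (hG : IsUnitPoissonPoints P G) {k : ℕ} (hk : 1 ≤ k) :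
    HasLaw (G k) (gammaMeasure k 1) P := by
  induction k, hk using Nat.le_induction with
  | base =>
    have h := hG.spacing_law 0
    rw [Nat.cast_one]
    refine h.congr ?_
    filter_upwards [hG.start] with ω hω
    simp [hω]
  | succ k hk ih =>
    have hind : IndepFun (G k) (fun ω => G (k + 1) ω - G k ω) P := by
      have h := hG.indepFun_spacing k (f := fun v => ∑ i, v i) (by fun_prop)
      refine h.congr ?_ (ae_eq_refl _)
      filter_upwards [hG.ae_eq_sum] with ω hω
      rw [hω k]
      exact Finset.sum_coe_sort (Finset.range k) (fun i => G (i + 1) ω - G i ω)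
    have hk0 : (0 : ℝ) < k := by exact_mod_cast hk
    have := isProbabilityMeasure_gammaMeasure hk0 one_pos
    have := isProbabilityMeasure_expMeasure one_pos
    have h := hind.hasLaw_add ih (hG.spacing_law k)
    rw [expMeasure, gammaMeasure_conv_one hk0 one_pos] at h
    rw [Nat.cast_succ]
    refine h.congr (Eventually.of_forall fun ω => ?_)
    simp

lemma ae_pos (hG : IsUnitPoissonPoints P G) : ∀ᵐ ω ∂P, ∀ k, 0 < G (k + 1) ω :=
  ae_all_iff.2 fun k => ((hG.hasLaw_gamma (Nat.le_add_left 1 k)).ae_iff (p := fun y => 0 < y)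
    (measurableSet_setOfPred.1 measurableSet_Ioi)).2 (gammaMeasure_ae_pos _ _)

lemma ae_ne (hG : IsUnitPoissonPoints P G) (t : ℝ) : ∀ᵐ ω ∂P, ∀ k, G (k + 1) ω ≠ t :=
  ae_all_iff.2 fun k => ((hG.hasLaw_gamma (Nat.le_add_left 1 k)).ae_iff (p := fun y => y ≠ t)
    (measurableSet_setOfPred.1 (measurableSet_singleton t).compl)).2
    (measure_eq_zero_iff_ae_notMem.1 (gammaMeasure_singleton _ _ t))

/-- If all points stay below T, then so does the (k+1)-st, an event of probability 1 - `poissonSum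
(k + 1) T`, which tends to 0 in k. -/
lemma ae_tendsto [IsProbabilityMeasure P] (hG : IsUnitPoissonPoints P G) :
    ∀ᵐ ω ∂P, Tendsto (fun k => G k ω) atTop atTop := by
  have h : ∀ᵐ ω ∂P, ∀ T : ℕ, ∃ k, (T : ℝ) < G k ω := by
    refine ae_all_iff.2 fun T => ?_
    have hle : ∀ k : ℕ, P.real {ω | ¬ ∃ k, (T : ℝ) < G k ω} ≤ 1 - poissonSum (k + 1) T := by
      intro k
      have hk := hG.hasLaw_gamma (Nat.le_add_left 1 k)
      have := isProbabilityMeasure_gammaMeasure (a := ((k + 1 : ℕ) : ℝ)) (by positivity) one_pos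
      calc P.real {ω | ¬ ∃ k, (T : ℝ) < G k ω} ≤ P.real {ω | G (k + 1) ω ≤ T} := by
            refine measureReal_mono fun ω hω => ?_
            simp only [not_exists, not_lt, mem_ofPred_eq] at hω ⊢
            exact hω _
        _ = (gammaMeasure ((k + 1 : ℕ) : ℝ) 1).real (Ioi (T : ℝ))ᶜ := by
            rw [compl_Ioi]
            exact hk.measureReal_eq measurableSet_Iic
        _ = 1 - poissonSum (k + 1) T := by
            rw [probReal_compl_eq_one_sub measurableSet_Ioi,
              gammaMeasure_real_Ioi (Nat.le_add_left 1 k) (Nat.cast_nonneg T)]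
    have hlim : Tendsto (fun k : ℕ => 1 - poissonSum (k + 1) T) atTop (𝓝 0) := by
      have := ((tendsto_poissonSum_nat (T : ℝ)).comp (tendsto_add_atTop_nat 1)).const_sub 1
      simpa using this
    have h0 := le_antisymm (ge_of_tendsto' hlim hle) measureReal_nonneg
    exact (measureReal_eq_zero_iff (measure_ne_top _ _)).1 h0
  filter_upwards [h, hG.ae_monotone] with ω h1 h2
  refine tendsto_atTop_atTop_of_monotone h2 fun b => ?_
  obtain ⟨T, hT⟩ := exists_nat_ge b
  obtain ⟨k, hk⟩ := h1 T
  exact ⟨k, hT.trans hk.le⟩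

end IsUnitPoissonPoints

/-! ### Expected products over Poisson points. -/

lemma integral_expMeasure_one (f : ℝ → ℝ) :
    ∫ s, f s ∂(expMeasure 1) = ∫ s in Ioi 0, Real.exp (-s) * f s := by
  rw [expMeasure, gammaMeasure, integral_withDensity_eq_integral_toReal_smul (f := gammaPDF 1 1)
    (measurable_gammaPDFReal 1 1).ennreal_ofReal (Eventually.of_forall fun x => by simp [gammaPDF]),
    ← integral_indicator measurableSet_Ioi]
  refine integral_congr_ae ?_
  have : ∀ᵐ s : ℝ, s ≠ 0 := Measure.ae_ne volume 0
  filter_upwards [this] with s hs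
  rcases lt_or_gt_of_ne hs with h | h
  · simp [gammaPDF_of_neg h, h.le]
  · rw [indicator_of_mem (mem_Ioi.2 h), gammaPDF_of_nonneg h.le,
      ENNReal.toReal_ofReal (by simp; positivity)]
    simp

/-- The weight `w` is a bounded factor with values in `[0, 1]`, continuous off a countable set and
equal to one beyond `T`. -/
structure IsStepWeight (w : ℝ → ℝ) (T : ℝ) : Prop where
  measurable : Measurable w
  nonneg : ∀ u, 0 ≤ w u
  le_one : ∀ u, w u ≤ 1
  eq_one : ∀ u, T ≤ u → w u = 1
  continuousAt_off : ∃ N : Set ℝ, N.Countable ∧ ∀ u, u ∉ N → ContinuousAt w u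

namespace IsStepWeight

variable {w : ℝ → ℝ} {T : ℝ}

/-- The function `s ↦ exp (-∫_s^T (1 - w))`. -/
def tailExp (w : ℝ → ℝ) (T s : ℝ) : ℝ := Real.exp (∫ u in T..s, (1 - w u))

lemma intervalIntegrable (hw : IsStepWeight w T) (s t : ℝ) :
    IntervalIntegrable (fun u => 1 - w u) volume s t := by
  refine (intervalIntegrable_const (c := (1 : ℝ))).mono_fun
    (measurable_const.sub hw.measurable).aestronglyMeasurable (Eventually.of_forall fun u => ?_)
  show ‖1 - w u‖ ≤ ‖(1 : ℝ)‖
  rw [Real.norm_of_nonneg (by linarith [hw.le_one u]), norm_one]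
  linarith [hw.nonneg u]

lemma continuous_tailExp (hw : IsStepWeight w T) : Continuous (tailExp w T) :=
  Real.continuous_exp.comp (intervalIntegral.continuous_primitive hw.intervalIntegrable T)

lemma tailExp_nonneg (w : ℝ → ℝ) (T s : ℝ) : 0 ≤ tailExp w T s := (Real.exp_pos _).le

lemma tailExp_of_ge (hw : IsStepWeight w T) {s : ℝ} (hs : T ≤ s) : tailExp w T s = 1 := by
  have : ∫ u in T..s, (1 - w u) = ∫ u in T..s, (0 : ℝ) := by
    refine intervalIntegral.integral_congr fun u hu => ?_
    rw [uIcc_of_le hs] at hu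
    simp [hw.eq_one u hu.1]
  simp [tailExp, this]

lemma tailExp_le_one (hw : IsStepWeight w T) (s : ℝ) : tailExp w T s ≤ 1 := by
  rcases le_total T s with h | h
  · exact (hw.tailExp_of_ge h).le
  · rw [tailExp, Real.exp_le_one_iff, intervalIntegral.integral_symm, neg_nonpos]
    exact intervalIntegral.integral_nonneg h fun u _ => by linarith [hw.le_one u]

/-- Heuristically `tailExp w T s` is the expected product of `w` over the points of a unit rate
process started at s, and this is the equation obtained by conditioning on the first point.
Analytically, -e^{-s} `tailExp w T (g + s)` is an antiderivative of the integrand off the countable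
set where `w` may jump, and it vanishes at infinity. -/
lemma integral_tailExp (hw : IsStepWeight w T) (g : ℝ) :
    ∫ s, w (g + s) * tailExp w T (g + s) ∂(expMeasure 1) = tailExp w T g := by
  rw [integral_expMeasure_one]
  obtain ⟨N, hN, hcont⟩ := hw.continuousAt_off
  set F : ℝ → ℝ := fun s => -(Real.exp (-s) * tailExp w T (g + s)) with hF
  set f : ℝ → ℝ := fun s => Real.exp (-s) * (w (g + s) * tailExp w T (g + s)) with hf
  have hFc : Continuous F := by
    have := hw.continuous_tailExp
    fun_prop
  have hfm : Measurable f := by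
    have := hw.continuous_tailExp.measurable
    have := hw.measurable
    fun_prop
  have hfi : IntegrableOn f (Ioi 0) := by
    have h0 : IntegrableOn (fun s : ℝ => Real.exp (-s)) (Ioi 0) := by
      simpa using integrableOn_exp_neg_Ioi 0
    refine Integrable.mono' h0 hfm.aestronglyMeasurable (Eventually.of_forall fun s => ?_)
    have h1 := hw.nonneg (g + s)
    have h2 := tailExp_nonneg w T (g + s)
    rw [Real.norm_of_nonneg (by positivity)]
    refine mul_le_of_le_one_right (Real.exp_pos _).le ?_
    exact mul_le_one₀ (hw.le_one _) h2 (hw.tailExp_le_one _)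
  have hderiv : ∀ s, s ∉ (fun s => g + s) ⁻¹' N → HasDerivAt F (f s) s := by
    intro s hs
    have hc : ContinuousAt (fun u => 1 - w u) (g + s) := continuousAt_const.sub (hcont _ hs)
    have h1 : HasDerivAt (fun x => ∫ u in T..x, (1 - w u)) (1 - w (g + s)) (g + s) :=
      intervalIntegral.integral_hasDerivAt_right (hw.intervalIntegrable _ _)
        ((measurable_const.sub hw.measurable).stronglyMeasurable.stronglyMeasurableAtFilter) hc
    have h2 := (h1.exp.comp_const_add g s)
    have h3 := ((hasDerivAt_neg s).exp.mul h2).neg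
    refine h3.congr_deriv ?_
    simp only [hf, tailExp]
    ring
  have hint : ∀ R, 0 ≤ R → ∫ s in (0 : ℝ)..R, f s = F R - F 0 := by
    intro R hR
    refine integral_eq_of_hasDerivAt_off_countable_of_le F f hR
      (hN.preimage (add_right_injective g)) hFc.continuousOn (fun s hs => hderiv s hs.2) ?_
    rw [intervalIntegrable_iff_integrableOn_Ioc_of_le hR]
    exact hfi.mono_set Ioc_subset_Ioi_self
  have hlim1 := intervalIntegral_tendsto_integral_Ioi 0 hfi tendsto_id
  have hF0 : Tendsto F atTop (𝓝 0) := by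
    have h0 : Tendsto (fun s : ℝ => Real.exp (-s)) atTop (𝓝 0) := Real.tendsto_exp_neg_atTop_nhds_zero
    have : Tendsto (fun s => Real.exp (-s) * tailExp w T (g + s)) atTop (𝓝 0) := by
      refine squeeze_zero (fun s => ?_) (fun s => ?_) h0
      · exact mul_nonneg (Real.exp_pos _).le (tailExp_nonneg _ _ _)
      · exact mul_le_of_le_one_right (Real.exp_pos _).le (hw.tailExp_le_one _)
    simpa using this.neg
  have hlim2 : Tendsto (fun R => ∫ s in (0 : ℝ)..R, f s) atTop (𝓝 (0 - F 0)) := by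
    refine (hF0.sub_const (F 0)).congr' ?_
    filter_upwards [eventually_ge_atTop 0] with R hR
    exact (hint R hR).symm
  rw [tendsto_nhds_unique hlim1 hlim2]
  simp [hF]

end IsStepWeight

namespace IsUnitPoissonPoints

variable {Ω : Type*} [MeasurableSpace Ω] {P : Measure Ω} [IsProbabilityMeasure P] {G : ℕ → Ω → ℝ}
  {w : ℝ → ℝ} {T : ℝ}

open IsStepWeight

/-- The integrand is a martingale in m: integrating out the last spacing by `integral_tailExp`
removes one factor. -/
lemma integral_prod_mul_tailExp (hG : IsUnitPoissonPoints P G) (hw : IsStepWeight w T) (m : ℕ) :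
    ∫ ω, (∏ k ∈ Finset.range m, w (G (k + 1) ω)) * tailExp w T (G m ω) ∂P = tailExp w T 0 := by
  have hwm := hw.measurable
  have hΦm := hw.continuous_tailExp.measurable
  induction m with
  | zero =>
    have : ∀ᵐ ω ∂P, (∏ k ∈ Finset.range 0, w (G (k + 1) ω)) * tailExp w T (G 0 ω) =
        tailExp w T 0 := by
      filter_upwards [hG.start] with ω hω
      simp [hω]
    rw [integral_congr_ae this]
    simp
  | succ m ih =>
    set R : Ω → ℝ × ℝ := fun ω => (∏ k ∈ Finset.range m, w (G (k + 1) ω), G m ω) with hR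
    set E : Ω → ℝ := fun ω => G (m + 1) ω - G m ω with hE
    -- The partial product and `G m` are both functions of the first m spacings, hence independent
    -- of the next one.
    have hind : IndepFun R E P := by
      have h := hG.indepFun_spacing m (f := fun v : Finset.range m → ℝ =>
        (∏ k ∈ Finset.range m,
          w (∑ i ∈ Finset.univ.filter (fun i : Finset.range m => (i : ℕ) < k + 1), v i),
          ∑ i, v i)) (by fun_prop)
      refine h.congr ?_ (ae_eq_refl _)
      filter_upwards [hG.ae_eq_sum] with ω hω
      refine Prod.ext ?_ ?_
      · simp only [hR]
        refine Finset.prod_congr rfl fun k hk => ?_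
        congr 1
        rw [hω (k + 1), Finset.sum_filter, Finset.sum_coe_sort (Finset.range m)
          (fun i => if i < k + 1 then G (i + 1) ω - G i ω else 0), ← Finset.sum_filter]
        refine Finset.sum_congr ?_ fun _ _ => rfl
        ext i
        have := Finset.mem_range.1 hk
        simp only [Finset.mem_filter, Finset.mem_range]
        omega
      · simp only [hR]
        rw [hω m]
        exact Finset.sum_coe_sort (Finset.range m) (fun i => G (i + 1) ω - G i ω)
    have hRm : AEMeasurable R P := by
      have := hG.aemeasurable
      refine AEMeasurable.prodMk ?_ (this m)
      exact Finset.aemeasurable_fun_prod _ fun k _ => hwm.comp_aemeasurable (this _)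
    have hEm : AEMeasurable E P := (hG.spacing_law m).aemeasurable
    have hR1 : ∀ᵐ r ∂(P.map R), ‖r.1‖ ≤ 1 := by
      refine (ae_map_iff hRm (measurableSet_le (by fun_prop) (by fun_prop))).2
        (Eventually.of_forall fun ω => ?_)
      rw [Real.norm_of_nonneg (Finset.prod_nonneg fun _ _ => hw.nonneg _)]
      exact Finset.prod_le_one (fun _ _ => hw.nonneg _) fun _ _ => hw.le_one _
    have hjoint := (indepFun_iff_map_prod_eq_prod_map_map hRm hEm).1 hind
    rw [(hG.spacing_law m).map_eq] at hjoint
    have : IsProbabilityMeasure (expMeasure 1) := isProbabilityMeasure_expMeasure one_pos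
    have : IsProbabilityMeasure (P.map R) := Measure.isProbabilityMeasure_map hRm
    let φ : (ℝ × ℝ) × ℝ → ℝ := fun q =>
      q.1.1 * (w (q.1.2 + q.2) * tailExp w T (q.1.2 + q.2))
    have hφm : Measurable φ := by fun_prop
    have h1 : ∀ ω, (∏ k ∈ Finset.range (m + 1), w (G (k + 1) ω)) * tailExp w T (G (m + 1) ω) =
        φ (R ω, E ω) := by
      intro ω
      simp only [φ, hR, hE, Finset.prod_range_succ]
      rw [add_sub_cancel]
      ring
    have hφi : Integrable φ ((P.map R).prod (expMeasure 1)) := by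
      refine Integrable.of_bound (C := 1) hφm.aestronglyMeasurable ?_
      have : ∀ᵐ q ∂((P.map R).prod (expMeasure 1)), ‖q.1.1‖ ≤ 1 :=
        Measure.quasiMeasurePreserving_fst.ae hR1
      filter_upwards [this] with q hq
      have h2 := tailExp_nonneg w T (q.1.2 + q.2)
      rw [norm_mul]
      refine mul_le_one₀ hq (norm_nonneg _) ?_
      rw [Real.norm_of_nonneg (mul_nonneg (hw.nonneg _) h2)]
      exact mul_le_one₀ (hw.le_one _) h2 (hw.tailExp_le_one _)
    simp_rw [h1]
    rw [← integral_map (f := φ) (hRm.prodMk hEm) hφm.aestronglyMeasurable, hjoint,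
      integral_prod _ hφi]
    simp only [φ, integral_const_mul, hw.integral_tailExp]
    rw [integral_map (f := fun r : ℝ × ℝ => r.1 * tailExp w T r.2) hRm
      (by fun_prop)]
    exact ih

/-- Products of a weight over the points of a unit rate Poisson process. -/
theorem integral_of_tendsto_prod (hG : IsUnitPoissonPoints P G) (hw : IsStepWeight w T)
    {R : Ω → ℝ}
    (hR : ∀ᵐ ω ∂P, Tendsto (fun m => ∏ k ∈ Finset.range m, w (G (k + 1) ω)) atTop (𝓝 (R ω))) :
    ∫ ω, R ω ∂P = Real.exp (-∫ u in (0 : ℝ)..T, (1 - w u)) := by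
  have hwm := hw.measurable
  have hΦm := hw.continuous_tailExp.measurable
  have hGm := hG.aemeasurable
  have hlim : Tendsto (fun m => ∫ ω, (∏ k ∈ Finset.range m, w (G (k + 1) ω)) *
      tailExp w T (G m ω) ∂P) atTop (𝓝 (∫ ω, R ω ∂P)) := by
    refine tendsto_integral_of_dominated_convergence (fun _ => 1) (fun m => ?_)
      (integrable_const _) (fun m => Eventually.of_forall fun ω => ?_) ?_
    · refine AEMeasurable.aestronglyMeasurable (AEMeasurable.mul ?_ ?_)
      · exact Finset.aemeasurable_fun_prod _ fun k _ => hwm.comp_aemeasurable (hGm _)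
      · exact hΦm.comp_aemeasurable (hGm m)
    · have h0 : 0 ≤ ∏ k ∈ Finset.range m, w (G (k + 1) ω) :=
        Finset.prod_nonneg fun _ _ => hw.nonneg _
      have h1 := tailExp_nonneg w T (G m ω)
      rw [Real.norm_of_nonneg (mul_nonneg h0 h1)]
      exact mul_le_one₀ (Finset.prod_le_one (fun _ _ => hw.nonneg _) fun _ _ => hw.le_one _) h1
        (hw.tailExp_le_one _)
    -- Points tend to infinity, so the compensating factor is eventually equal to 1.
    · filter_upwards [hR, hG.ae_tendsto] with ω h1 h2
      refine h1.congr' ?_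
      filter_upwards [h2.eventually_ge_atTop T] with m hm
      rw [hw.tailExp_of_ge hm, mul_one]
  simp_rw [hG.integral_prod_mul_tailExp hw] at hlim
  rw [← tendsto_nhds_unique tendsto_const_nhds hlim, tailExp, intervalIntegral.integral_symm]

end IsUnitPoissonPoints

/-! ## Weak convergence on a countable power of the unit interval -/

section Cube

variable {ι : Type*}

/-- The coordinate functions on a power of the unit interval. -/
def cubeCoord (i : ι) : C(ι → unitInterval, ℝ) := ⟨fun z => (z i : ℝ), by fun_prop⟩

lemma exists_monomial_of_mem_closure {g : C(ι → unitInterval, ℝ)}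
    (hg : g ∈ Submonoid.closure (range (cubeCoord (ι := ι)))) :
    ∃ f : ι →₀ ℕ, ∀ z, g z = f.prod fun i k => (z i : ℝ) ^ k := by
  induction hg using Submonoid.closure_induction with
  | mem x hx =>
    obtain ⟨i, rfl⟩ := hx
    exact ⟨Finsupp.single i 1, fun z => by simp [cubeCoord]⟩
  | one => exact ⟨0, fun z => by simp⟩
  | mul x y _ _ hx hy =>
    obtain ⟨f, hf⟩ := hx
    obtain ⟨f', hf'⟩ := hy
    refine ⟨f + f', fun z => ?_⟩
    rw [Finsupp.prod_add_index' (by simp) (by intros; rw [pow_add]), ← hf, ← hf']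
    rfl

/-- Integration of continuous functions against a finite measure on a power of the unit interval. -/
def cubeIntegral [Countable ι] (m : Measure (ι → unitInterval)) [IsFiniteMeasure m] :
    C(ι → unitInterval, ℝ) →ₗ[ℝ] ℝ where
  toFun f := ∫ z, f z ∂m
  map_add' f g := integral_add ((BoundedContinuousFunction.mkOfCompact f).integrable m)
    ((BoundedContinuousFunction.mkOfCompact g).integrable m)
  map_smul' c _ := integral_const_mul c _

lemma abs_cubeIntegral_le [Countable ι] (m : Measure (ι → unitInterval)) [IsProbabilityMeasure m]
    (f : C(ι → unitInterval, ℝ)) : |cubeIntegral m f| ≤ 1 * ‖f‖ := by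
  have := norm_integral_le_of_norm_le_const (μ := m) (f := f)
    (Eventually.of_forall fun z => f.norm_coe_le_norm z)
  simpa [cubeIntegral] using this

/-- Method of moments: the monomials form a multiplicative family separating the points of a compact
cube, so `tendsto_functional_of_separating` applies even with infinitely many coordinates. -/
theorem tendsto_probabilityMeasure_cube [Countable ι] (m : ℕ → ProbabilityMeasure (ι → unitInterval))
    (m₀ : ProbabilityMeasure (ι → unitInterval))
    (h : ∀ f : ι →₀ ℕ, Tendsto
      (fun n => ∫ z, (f.prod fun i k => (z i : ℝ) ^ k) ∂(m n : Measure (ι → unitInterval))) atTop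
      (𝓝 (∫ z, (f.prod fun i k => (z i : ℝ) ^ k) ∂(m₀ : Measure (ι → unitInterval))))) :
    Tendsto m atTop (𝓝 m₀) := by
  refine ProbabilityMeasure.tendsto_iff_forall_integral_tendsto.2 fun f => ?_
  refine tendsto_functional_of_separating
    (fun n => cubeIntegral (m n : Measure (ι → unitInterval)))
    (cubeIntegral (m₀ : Measure (ι → unitInterval))) 1
    (Eventually.of_forall fun n => abs_cubeIntegral_le _) (abs_cubeIntegral_le _)
    (Submonoid.closure (range (cubeCoord (ι := ι)))) ?_ ?_ f.toContinuousMap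
  · intro x y hxy
    obtain ⟨i, hi⟩ := Function.ne_iff.1 hxy
    exact ⟨cubeCoord i, Submonoid.subset_closure ⟨i, rfl⟩, fun h => hi (Subtype.ext h)⟩
  · intro g hg
    obtain ⟨f, hf⟩ := exists_monomial_of_mem_closure hg
    simpa [cubeIntegral, hf] using h f

/-! ## Sequences encoded by their level counts -/

/-- The nonnegative sequence `x` is encoded by `z`: for each level `d i`, `z i ≤ 2^{-(k+1)}` if
`x k` exceeds the level, and `z i ≥ 2^{-k}` otherwise. -/
structure LevelCode (d : ι → ℝ) (z : ι → unitInterval) (x : ℕ → ℝ) : Prop where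
  nonneg : ∀ k, 0 ≤ x k
  le_of_lt : ∀ k i, d i < x k → (z i : ℝ) ≤ (1 / 2) ^ (k + 1)
  ge_of_le : ∀ k i, x k ≤ d i → (1 / 2) ^ k ≤ (z i : ℝ)

/-- The levels are positive and dense in `(0, ∞)`. -/
structure DenseLevels (d : ι → ℝ) : Prop where
  pos : ∀ i, 0 < d i
  dense : ∀ a b, 0 ≤ a → a < b → ∃ i, a < d i ∧ d i < b

/-- Open sets of sequences are given by open sets of codes. -/
lemma exists_isOpen_levelCode {d : ι → ℝ} (hd : DenseLevels d) {U : Set (ℕ → ℝ)} (hU : IsOpen U) :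
    ∃ V : Set (ι → unitInterval), IsOpen V ∧ ∀ z x, LevelCode d z x → (x ∈ U ↔ z ∈ V) := by
  -- Pairs of a code and a sequence, topologised by the code alone. The claim becomes continuity of
  -- the sequence coordinate on this space.
  let M := {q : (ι → unitInterval) × (ℕ → ℝ) // LevelCode d q.1 q.2}
  let τ : TopologicalSpace M := TopologicalSpace.induced (fun q => q.1.1) inferInstance
  have hfst : Continuous (fun q : M => q.1.1) := continuous_induced_dom
  have hsnd : Continuous (fun q : M => q.1.2) := by
    refine continuous_pi fun k => ?_
    rw [OrderTopology.topology_eq_generate_intervals (α := ℝ), continuous_generateFrom_iff]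
    have hlt : ((1 : ℝ) / 2) ^ (k + 1) < (1 / 2) ^ k :=
      pow_lt_pow_right_of_lt_one₀ (by norm_num) (by norm_num) (Nat.lt_succ_self k)
    rintro _ ⟨c, rfl | rfl⟩
    · rcases lt_or_ge c 0 with hc | hc
      · convert isOpen_univ
        exact eq_univ_of_forall fun q => hc.trans_le (q.2.nonneg k)
      -- The gap between 2^{-(k+1)} and 2^{-k} turns d_i < x_k into the open condition z_i < 2^{-k},
      -- and density of the levels expresses x_k > c as a union of these.
      have : (fun q : M => q.1.2 k) ⁻¹' Ioi c =
          ⋃ i : {i // c < d i}, {q : M | (q.1.1 i : ℝ) < (1 / 2) ^ k} := by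
        ext q
        simp only [mem_preimage, mem_Ioi, mem_iUnion, mem_ofPred_eq]
        constructor
        · intro h
          obtain ⟨i, hi1, hi2⟩ := hd.dense c _ hc h
          exact ⟨⟨i, hi1⟩, (q.2.le_of_lt k i hi2).trans_lt hlt⟩
        · rintro ⟨⟨i, hi⟩, h⟩
          by_contra! hcon
          exact absurd (q.2.ge_of_le k i (hcon.trans hi.le)) (not_le.2 h)
      rw [this]
      exact isOpen_iUnion fun i => isOpen_lt (by fun_prop) continuous_const
    · have : (fun q : M => q.1.2 k) ⁻¹' Iio c =
          ⋃ i : {i // d i < c}, {q : M | (1 / 2) ^ (k + 1) < (q.1.1 i : ℝ)} := by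
        ext q
        simp only [mem_preimage, mem_Iio, mem_iUnion, mem_ofPred_eq]
        constructor
        · intro h
          obtain ⟨i, hi1, hi2⟩ := hd.dense _ c (q.2.nonneg k) h
          exact ⟨⟨i, hi2⟩, hlt.trans_le (q.2.ge_of_le k i hi1.le)⟩
        · rintro ⟨⟨i, hi⟩, h⟩
          by_contra! hcon
          exact absurd (q.2.le_of_lt k i (hi.trans_le hcon)) (not_le.2 h)
      rw [this]
      exact isOpen_iUnion fun i => isOpen_lt continuous_const (by fun_prop)
  obtain ⟨V, hV, hVU⟩ := isOpen_induced_iff.1 (hU.preimage hsnd)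
  refine ⟨V, hV, fun z x hzx => ?_⟩
  have := congrArg (fun s => (⟨(z, x), hzx⟩ : M) ∈ s) hVU
  simpa using this.symm

/-- Portmanteau for open sets: membership of the sequence in an open set is almost surely membership
of its code in a fixed open set, so no decoding map defined on the whole cube is needed. -/
theorem tendstoInDistribution_of_levelCode [Countable ι] {Ω Ω' : Type*} [MeasurableSpace Ω]
    [MeasurableSpace Ω'] {P : Measure Ω} [IsProbabilityMeasure P] {P' : Measure Ω'}
    [IsProbabilityMeasure P'] {d : ι → ℝ} (hd : DenseLevels d)
    {Z : ℕ → Ω → ι → unitInterval} {Z' : Ω' → ι → unitInterval} {X : ℕ → Ω → ℕ → ℝ}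
    {Y : Ω' → ℕ → ℝ} (hZ : TendstoInDistribution Z atTop Z' (fun _ => P) P')
    (hX : ∀ n, AEMeasurable (X n) P) (hY : AEMeasurable Y P')
    (hZX : ∀ n, ∀ᵐ ω ∂P, LevelCode d (Z n ω) (X n ω))
    (hZY : ∀ᵐ ω ∂P', LevelCode d (Z' ω) (Y ω)) :
    TendstoInDistribution X atTop Y (fun _ => P) P' where
  forall_aemeasurable := hX
  aemeasurable_limit := hY
  tendsto := by
    refine tendsto_of_forall_isOpen_le_liminf' fun U hU => ?_
    obtain ⟨V, hV, hVU⟩ := exists_isOpen_levelCode hd hU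
    have h := ProbabilityMeasure.le_liminf_measure_open_of_tendsto hZ.tendsto hV
    simp only [ProbabilityMeasure.coe_mk] at h ⊢
    have h1 : P'.map Y U = P'.map Z' V := by
      rw [Measure.map_apply_of_aemeasurable hY hU.measurableSet,
        Measure.map_apply_of_aemeasurable hZ.aemeasurable_limit hV.measurableSet]
      refine measure_congr ?_
      filter_upwards [hZY] with ω hω
      exact propext (hVU _ _ hω)
    have h2 : ∀ n, P.map (X n) U = P.map (Z n) V := fun n => by
      rw [Measure.map_apply_of_aemeasurable (hX n) hU.measurableSet,
        Measure.map_apply_of_aemeasurable (hZ.forall_aemeasurable n) hV.measurableSet]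
      refine measure_congr ?_
      filter_upwards [hZX n] with ω hω
      exact propext (hVU _ _ hω)
    simpa only [h1, h2] using h

end Cube

/-- A σ-finite measure has countably many atoms, so every rational interval in [0, ∞) contains a
non-atom. Pairs not bounding such an interval receive an arbitrary positive non-atom. -/
lemma exists_denseLevels {ρ : Measure ℝ} (hρ : IsLevyMeasure ρ) :
    ∃ d : ℚ × ℚ → ℝ, (∀ q, ρ {d q} = 0) ∧ DenseLevels d := by
  have := hρ.sigmaFinite
  have hc : {t : ℝ | 0 < ρ {t}}.Countable :=
    Measure.countable_meas_level_set_pos (μ := ρ) measurable_id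
  have hdense := hc.dense_compl ℝ
  have hex : ∀ q : ℚ × ℚ, ∃ t : ℝ, ρ {t} = 0 ∧ 0 < t ∧
      (0 ≤ q.1 → q.1 < q.2 → (q.1 : ℝ) < t ∧ t < q.2) := by
    intro q
    by_cases hq : 0 ≤ q.1 ∧ q.1 < q.2
    · obtain ⟨t, ht, h1⟩ := hdense.exists_mem_open (isOpen_Ioo (a := (q.1 : ℝ)) (b := q.2))
        (nonempty_Ioo.2 (by exact_mod_cast hq.2))
      refine ⟨t, ?_, ?_, fun _ _ => h1⟩
      · simpa using ht
      · exact lt_of_le_of_lt (by exact_mod_cast hq.1) h1.1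
    · obtain ⟨t, ht, h1⟩ := hdense.exists_mem_open (isOpen_Ioi (a := (0 : ℝ))) ⟨1, by simp⟩
      refine ⟨t, ?_, h1, fun h2 h3 => absurd ⟨h2, h3⟩ hq⟩
      simpa using ht
  choose d h1 h2 h3 using hex
  refine ⟨d, h1, h2, fun a b ha hab => ?_⟩
  obtain ⟨p, hp1, hp2⟩ := exists_rat_btwn hab
  obtain ⟨q, hq1, hq2⟩ := exists_rat_btwn hp2
  have hp0 : 0 ≤ p := by exact_mod_cast ha.trans hp1.le
  have := h3 (p, q) hp0 (by exact_mod_cast hq1)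
  exact ⟨(p, q), hp1.trans this.1, this.2.trans hq2⟩

/-! ## Products of threshold factors -/

/-- When `p i` implies all other conditions, inserting i changes the product only where every
condition holds, so the correction is a single constant on a single set. -/
lemma prod_ite_insert {ι : Type*} [DecidableEq ι] {S : Finset ι} {i : ι} (hi : i ∉ S)
    (p : ι → Prop) [DecidablePred p] (hp : ∀ j ∈ S, p i → p j) (z : ι → ℝ) :
    1 - ∏ j ∈ insert i S, (if p j then z j else 1) =
      (1 - ∏ j ∈ S, (if p j then z j else 1)) +
        if p i then (1 - z i) * ∏ j ∈ S, z j else 0 := by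
  rw [Finset.prod_insert hi]
  by_cases h : p i
  · rw [Finset.prod_congr rfl fun j hj => if_pos (hp j hj h)]
    simp only [h, if_true]
    ring
  · simp [h]

lemma intervalIntegral_ite_lt {t T : ℝ} (ht : 0 ≤ t) (htT : t ≤ T) (c : ℝ) :
    IntervalIntegrable (fun u => if u < t then c else 0) volume 0 T ∧
      ∫ u in (0 : ℝ)..T, (if u < t then c else 0) = c * t := by
  have h : (fun u => if u < t then c else 0) = (Iio t).indicator (fun _ => c) := by
    ext u
    simp [indicator]
  rw [h, intervalIntegrable_iff_integrableOn_Ioc_of_le (ht.trans htT)]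
  constructor
  · exact (integrableOn_const (by simp)).indicator measurableSet_Iio
  · rw [intervalIntegral.integral_of_le (ht.trans htT), setIntegral_indicator measurableSet_Iio]
    have : Ioc 0 T ∩ Iio t = Ioo 0 t := by
      ext u
      simp only [mem_inter_iff, mem_Ioc, mem_Iio, mem_Ioo]
      constructor
      · rintro ⟨⟨h1, -⟩, h2⟩
        exact ⟨h1, h2⟩
      · rintro ⟨h1, h2⟩
        exact ⟨⟨h1, h2.le.trans htT⟩, h2⟩
    rw [this]
    simp [ht, mul_comm]

section Thresholds

variable {ι : Type*}

lemma prod_ite_mem_Icc (S : Finset ι) (p : ι → Prop) [DecidablePred p] {z : ι → ℝ}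
    (hz : ∀ i, z i ∈ Icc 0 1) : ∏ i ∈ S, (if p i then z i else 1) ∈ Icc (0 : ℝ) 1 := by
  constructor
  · refine Finset.prod_nonneg fun i _ => ?_
    split_ifs
    exacts [(hz i).1, zero_le_one]
  · refine Finset.prod_le_one (fun i _ => ?_) fun i _ => ?_
    · split_ifs
      exacts [(hz i).1, zero_le_one]
    · split_ifs
      exacts [(hz i).2, le_rfl]

lemma isStepWeight_prod_ite (S : Finset ι) (t : ι → ℝ) {T : ℝ} (hT : ∀ i ∈ S, t i ≤ T)
    {z : ι → ℝ} (hz : ∀ i, z i ∈ Icc 0 1) :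
    IsStepWeight (fun u => ∏ i ∈ S, (if u < t i then z i else 1)) T where
  measurable := Finset.measurable_fun_prod _ fun i _ =>
    Measurable.ite measurableSet_Iio measurable_const measurable_const
  nonneg u := (prod_ite_mem_Icc S (fun i => u < t i) hz).1
  le_one u := (prod_ite_mem_Icc S (fun i => u < t i) hz).2
  eq_one u hu := Finset.prod_eq_one fun i hi => if_neg (not_lt.2 ((hT i hi).trans hu))
  continuousAt_off := by
    refine ⟨t '' S, (S.finite_toSet.image t).countable, fun u hu => ?_⟩
    refine tendsto_finsetProd _ fun i hi => ?_
    have hne : u ≠ t i := fun h => hu ⟨i, hi, h.symm⟩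
    rcases lt_or_gt_of_ne hne with h | h
    · have : (fun u => if u < t i then z i else 1) =ᶠ[𝓝 u] fun _ => z i := by
        filter_upwards [eventually_lt_nhds h] with v hv using if_pos hv
      exact (continuousAt_const.congr this.symm).tendsto
    · have : (fun u => if u < t i then z i else 1) =ᶠ[𝓝 u] fun _ => 1 := by
        filter_upwards [eventually_gt_nhds h] with v hv using if_neg (not_lt.2 hv.le)
      exact (continuousAt_const.congr this.symm).tendsto

/-- Convergence of tails gives convergence of the rescaled integrals of products of threshold
factors; the limit is expressed in the time scale of the tail. -/
lemma tendsto_integral_one_sub_prod_ite (S : Finset ι) {d t z : ι → ℝ} {T : ℝ}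
    (hz : ∀ i, z i ∈ Icc 0 1) (ht0 : ∀ i, 0 ≤ t i) (hT : ∀ i ∈ S, t i ≤ T)
    (hanti : ∀ i j, d i ≤ d j → t j ≤ t i) {μ : ℕ → Measure ℝ}
    (hμ : ∀ n, IsProbabilityMeasure (μ n))
    (hlim : ∀ i, Tendsto (fun n : ℕ => n * (μ n).real (Ioi (d i))) atTop (𝓝 (t i))) :
    Tendsto (fun n : ℕ => n * ∫ x, (1 - ∏ i ∈ S, (if d i < x then z i else 1)) ∂(μ n)) atTop
      (𝓝 (∫ u in (0 : ℝ)..T, (1 - ∏ i ∈ S, (if u < t i then z i else 1)))) := by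
  classical
  -- The inserted level is the highest one, so in the x-integral its correction is a constant times
  -- one tail n·μ_n((d_i, ∞)); in the time scale it is the same constant times t_i.
  induction S using Finset.induction_on_max_value d with
  | empty => simp
  | insert i S hi hmax ih =>
    have hTi := hT i (Finset.mem_insert_self i S)
    have hTS : ∀ j ∈ S, t j ≤ T := fun j hj => hT j (Finset.mem_insert_of_mem hj)
    obtain ⟨hint, hval⟩ := intervalIntegral_ite_lt (ht0 i) hTi ((1 - z i) * ∏ j ∈ S, z j)
    have h1 : ∀ u, 1 - ∏ j ∈ insert i S, (if u < t j then z j else 1) =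
        (1 - ∏ j ∈ S, (if u < t j then z j else 1)) +
          if u < t i then (1 - z i) * ∏ j ∈ S, z j else 0 := fun u =>
      prod_ite_insert hi (fun j => u < t j)
        (fun j hj hu => hu.trans_le (hanti j i (hmax j hj))) z
    have h2 : ∀ x, 1 - ∏ j ∈ insert i S, (if d j < x then z j else 1) =
        (1 - ∏ j ∈ S, (if d j < x then z j else 1)) +
          if d i < x then (1 - z i) * ∏ j ∈ S, z j else 0 := fun x =>
      prod_ite_insert hi (fun j => d j < x) (fun j hj hu => (hmax j hj).trans_lt hu) z
    simp_rw [h1, h2]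
    rw [intervalIntegral.integral_add
      ((isStepWeight_prod_ite S t hTS hz).intervalIntegrable 0 T) hint, hval]
    have h3 : ∀ n : ℕ, n * ∫ x, ((1 - ∏ j ∈ S, (if d j < x then z j else 1)) +
          if d i < x then (1 - z i) * ∏ j ∈ S, z j else 0) ∂(μ n) =
        n * (∫ x, (1 - ∏ j ∈ S, (if d j < x then z j else 1)) ∂(μ n)) +
          ((1 - z i) * ∏ j ∈ S, z j) * (n * (μ n).real (Ioi (d i))) := by
      intro n
      have h4 : (fun x => if d i < x then (1 - z i) * ∏ j ∈ S, z j else 0) =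
          (Ioi (d i)).indicator (fun _ => (1 - z i) * ∏ j ∈ S, z j) := by
        ext x
        simp [indicator]
      rw [integral_add, h4, integral_indicator_const _ measurableSet_Ioi, smul_eq_mul]
      · ring
      · refine Integrable.of_bound (C := 1) ?_ (Eventually.of_forall fun x => ?_)
        · refine (measurable_const.sub ?_).aestronglyMeasurable
          exact Finset.measurable_fun_prod _ fun j _ =>
            Measurable.ite measurableSet_Ioi measurable_const measurable_const
        · have := prod_ite_mem_Icc S (fun j => d j < x) hz
          rw [Real.norm_of_nonneg (by linarith [this.2])]
          linarith [this.1]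
      · rw [h4]
        exact (integrable_const _).indicator measurableSet_Ioi
    simp_rw [h3]
    exact (ih hTS).add ((hlim i).const_mul _)

end Thresholds

/-! ## Level codes of finite families and of Poisson points -/

/-- The code of a finite family: level `d i` is sent to `2^{-N}`, `N` the number of terms above. -/
def arrayCode {ι : Type*} (d : ι → ℝ) {n : ℕ} (x : Fin n → ℝ) (i : ι) : unitInterval :=
  ⟨(1 / 2) ^ (Finset.card {j | d i < x j}),
    by positivity, pow_le_one₀ (by norm_num) (by norm_num)⟩

lemma measurable_arrayCode {ι : Type*} (d : ι → ℝ) {n : ℕ} :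
    Measurable (fun x : Fin n → ℝ => arrayCode d x) := by
  refine measurable_pi_lambda _ fun i => Measurable.subtype_mk ?_
  exact (measurable_of_countable fun N : ℕ => ((1 : ℝ) / 2) ^ N).comp (measurable_card_lt (d i))

lemma levelCode_arrayCode {ι : Type*} {d : ι → ℝ} (hd : DenseLevels d) {n : ℕ} {x : Fin n → ℝ}
    (hx : ∀ j, 0 ≤ x j) : LevelCode d (arrayCode d x) (fun k => orderStat x (k + 1)) where
  nonneg k := orderStat_nonneg hx _
  le_of_lt k i h := by
    rw [lt_orderStat_iff x (Nat.le_add_left 1 k) (hd.pos i).le] at h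
    exact pow_le_pow_of_le_one (by norm_num) (by norm_num) h
  ge_of_le k i h := by
    have h' := (lt_orderStat_iff x (Nat.le_add_left 1 k) (hd.pos i).le).not.1 (not_lt.2 h)
    exact pow_le_pow_of_le_one (by norm_num) (by norm_num) (by omega)

/-- Regrouping by entries rather than by levels turns a mixed moment of the code into a product over
independent entries. -/
lemma arrayCode_pow {ι : Type*} (d : ι → ℝ) {n : ℕ} (x : Fin n → ℝ) (f : ι →₀ ℕ) :
    (f.prod fun i k => (arrayCode d x i : ℝ) ^ k) =
      ∏ j, ∏ i ∈ f.support, (if d i < x j then (1 / 2 : ℝ) ^ f i else 1) := by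
  rw [Finset.prod_comm]
  refine Finset.prod_congr rfl fun i _ => ?_
  simp only [arrayCode]
  rw [Finset.prod_ite, Finset.prod_const, Finset.prod_const_one, mul_one, ← pow_mul, ← pow_mul,
    mul_comm]

/-- The partial products `2^{-#{k < m : g k < t}}`. -/
def halfProd (g : ℕ → ℝ) (t : ℝ) (m : ℕ) : ℝ :=
  ∏ k ∈ Finset.range m, (if g k < t then 1 / 2 else 1)

lemma halfProd_nonneg (g : ℕ → ℝ) (t : ℝ) (m : ℕ) : 0 ≤ halfProd g t m :=
  Finset.prod_nonneg fun k _ => by split_ifs <;> norm_num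

lemma halfProd_antitone (g : ℕ → ℝ) (t : ℝ) : Antitone (halfProd g t) := by
  refine antitone_nat_of_succ_le fun m => ?_
  rw [halfProd, Finset.prod_range_succ]
  refine mul_le_of_le_one_right (halfProd_nonneg g t m) ?_
  split_ifs <;> norm_num

lemma bddBelow_halfProd (g : ℕ → ℝ) (t : ℝ) : BddBelow (range (halfProd g t)) :=
  ⟨0, by rintro _ ⟨m, rfl⟩; exact halfProd_nonneg g t m⟩

lemma tendsto_halfProd (g : ℕ → ℝ) (t : ℝ) :
    Tendsto (halfProd g t) atTop (𝓝 (⨅ m, halfProd g t m)) :=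
  tendsto_atTop_ciInf (halfProd_antitone g t) (bddBelow_halfProd g t)

/-- The code of an increasing sequence `g` with time levels `t`. -/
def pointsCode {ι : Type*} (t : ι → ℝ) (g : ℕ → ℝ) (i : ι) : unitInterval :=
  ⟨⨅ m, halfProd g (t i) m, le_ciInf fun m => halfProd_nonneg g (t i) m,
    (ciInf_le (bddBelow_halfProd g (t i)) 0).trans (by simp [halfProd])⟩

lemma measurable_pointsCode {ι : Type*} (t : ι → ℝ) : Measurable (pointsCode t) := by
  refine measurable_pi_lambda _ fun i => Measurable.subtype_mk ?_
  refine measurable_of_tendsto_metrizable (f := fun m g => halfProd g (t i) m) (fun m => ?_)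
    (tendsto_pi_nhds.2 fun g => tendsto_halfProd g (t i))
  exact Finset.measurable_fun_prod _ fun k _ => Measurable.ite
    (measurableSet_lt (measurable_pi_apply k) measurable_const) measurable_const measurable_const

/-- As g increases, the indices with g k < t i form an initial segment. If it contains k, the first
k + 1 factors equal 1/2; if not, all factors from index k on equal 1. -/
lemma levelCode_pointsCode {ι : Type*} {d t : ι → ℝ} {g x : ℕ → ℝ} (hg : Monotone g)
    (hx : ∀ k, 0 ≤ x k) (h : ∀ k i, d i < x k ↔ g k < t i) :
    LevelCode d (pointsCode t g) x where
  nonneg := hx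
  le_of_lt k i hk := by
    refine (ciInf_le (bddBelow_halfProd g (t i)) (k + 1)).trans ?_
    rw [halfProd, Finset.prod_congr rfl fun j hj => if_pos ((hg (Nat.lt_succ_iff.1
      (Finset.mem_range.1 hj))).trans_lt ((h k i).1 hk))]
    simp
  ge_of_le k i hk := by
    have hgk : t i ≤ g k := not_lt.1 ((h k i).not.1 (not_lt.2 hk))
    refine le_ciInf fun m => ?_
    have : ((1 : ℝ) / 2) ^ (min m k) ≤ halfProd g (t i) m := by
      induction m with
      | zero => simp [halfProd]
      | succ m ih =>
        rw [halfProd, Finset.prod_range_succ]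
        change _ ≤ halfProd g (t i) m * _
        rcases lt_or_ge m k with hmk | hmk
        · rw [min_eq_left (by omega), pow_succ]
          rw [min_eq_left hmk.le] at ih
          refine mul_le_mul ih ?_ (by norm_num) (halfProd_nonneg _ _ _)
          split_ifs <;> norm_num
        · rw [if_neg (not_lt.2 (hgk.trans (hg hmk))), mul_one, min_eq_right (by omega)]
          rwa [min_eq_right hmk] at ih
    exact (pow_le_pow_of_le_one (by norm_num) (by norm_num) (min_le_right m k)).trans this

lemma tendsto_prod_pointsCode {ι : Type*} (t : ι → ℝ) (g : ℕ → ℝ) (f : ι →₀ ℕ) :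
    Tendsto (fun m => ∏ k ∈ Finset.range m, ∏ i ∈ f.support,
        (if g k < t i then (1 / 2 : ℝ) ^ f i else 1)) atTop
      (𝓝 (f.prod fun i k => (pointsCode t g i : ℝ) ^ k)) := by
  have h : ∀ m, ∏ k ∈ Finset.range m, ∏ i ∈ f.support,
      (if g k < t i then (1 / 2 : ℝ) ^ f i else 1) =
      ∏ i ∈ f.support, (halfProd g (t i) m) ^ f i := by
    intro m
    rw [Finset.prod_comm]
    refine Finset.prod_congr rfl fun i _ => ?_
    rw [halfProd, ← Finset.prod_pow]
    refine Finset.prod_congr rfl fun k _ => ?_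
    split_ifs <;> simp
  simp_rw [h]
  exact tendsto_finsetProd _ fun i _ => (tendsto_halfProd g (t i)).pow (f i)

/-! ## Joint convergence of the order statistics -/

theorem tendstoInDistribution_orderStat {Ω Ω' : Type*} [MeasurableSpace Ω] [MeasurableSpace Ω']
    {P : Measure Ω} [IsProbabilityMeasure P] {P' : Measure Ω'} [IsProbabilityMeasure P']
    {ρ : Measure ℝ} (hρ : IsLevyMeasure ρ) {X : (n : ℕ) → Fin n → Ω → ℝ} {μ : ℕ → Measure ℝ}
    (hμ : ∀ n, IsProbabilityMeasure (μ n)) (hX : ∀ n j, HasLaw (X n j) (μ n) P)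
    (hind : ∀ n, iIndepFun (X n) P) (hμ0 : ∀ n, μ n (Iio 0) = 0)
    (htail : ∀ x, 0 < x → ρ {x} = 0 →
      Tendsto (fun n : ℕ => n * (μ n).real (Ioi x)) atTop (𝓝 (levyTail ρ x).toReal))
    {G : ℕ → Ω' → ℝ} (hG : IsUnitPoissonPoints P' G) :
    TendstoInDistribution (fun n ω (i : ℕ) => orderStat (fun j => X n j ω) (i + 1)) atTop
      (fun ω (i : ℕ) => invLevyTail ρ (G (i + 1) ω)) (fun _ => P) P' := by
  obtain ⟨d, hd0, hd⟩ := exists_denseLevels hρ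
  set t : ℚ × ℚ → ℝ := fun i => (levyTail ρ (d i)).toReal with ht
  have hfin : ∀ i, levyTail ρ (d i) ≠ ∞ := fun i => (hρ.levyTail_lt_top (hd.pos i)).ne
  have hXm : ∀ n, AEMeasurable (fun ω j => X n j ω) P := fun n =>
    aemeasurable_pi_lambda _ fun j => (hX n j).aemeasurable
  have hGm : AEMeasurable (fun ω k => G (k + 1) ω) P' :=
    aemeasurable_pi_lambda _ fun k => hG.aemeasurable (k + 1)
  have hZm : ∀ n, AEMeasurable (fun ω => arrayCode d (fun j => X n j ω)) P := fun n =>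
    (measurable_arrayCode d).comp_aemeasurable (hXm n)
  have hZ'm : AEMeasurable (fun ω => pointsCode t (fun k => G (k + 1) ω)) P' :=
    (measurable_pointsCode t).comp_aemeasurable hGm
  have hXpos : ∀ n, ∀ᵐ ω ∂P, ∀ j, 0 ≤ X n j ω := fun n => by
    have hμpos : ∀ᵐ y ∂(μ n), 0 ≤ y := by
      have : ∀ᵐ y ∂(μ n), y ∉ Iio 0 := measure_eq_zero_iff_ae_notMem.1 (hμ0 n)
      filter_upwards [this] with y hy using not_lt.1 hy
    exact ae_all_iff.2 fun j => ((hX n j).ae_iff (p := fun y => 0 ≤ y)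
      (measurableSet_setOfPred.1 measurableSet_Ici)).2 hμpos
  refine tendstoInDistribution_of_levelCode hd
    (Z := fun n ω => arrayCode d (fun j => X n j ω))
    (Z' := fun ω => pointsCode t (fun k => G (k + 1) ω)) ⟨hZm, hZ'm, ?_⟩ ?_ ?_ ?_ ?_
  · refine tendsto_probabilityMeasure_cube _ _ fun f => ?_
    simp only [ProbabilityMeasure.coe_mk]
    have hfc : Continuous (fun z : ℚ × ℚ → unitInterval => f.prod fun i k => (z i : ℝ) ^ k) := by
      unfold Finsupp.prod
      fun_prop
    set z : ℚ × ℚ → ℝ := fun i => (1 / 2) ^ f i with hz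
    have hz1 : ∀ i, z i ∈ Icc 0 1 := fun i =>
      ⟨by positivity, pow_le_one₀ (by norm_num) (by norm_num)⟩
    -- Any common upper bound of the finitely many time levels would serve as horizon.
    set T : ℝ := ∑ i ∈ f.support, t i
    have hT : ∀ i ∈ f.support, t i ≤ T := fun i hi =>
      Finset.single_le_sum (f := t) (fun _ _ => ENNReal.toReal_nonneg) hi
    have hw := isStepWeight_prod_ite f.support t hT hz1
    rw [integral_map hZ'm hfc.aestronglyMeasurable, hG.integral_of_tendsto_prod hw
      (Eventually.of_forall fun ω => tendsto_prod_pointsCode t (fun k => G (k + 1) ω) f)]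
    have hlim := (tendsto_integral_one_sub_prod_ite f.support (d := d) hz1
      (fun i => ENNReal.toReal_nonneg) hT
      (fun i j hij => ENNReal.toReal_mono (hfin i) (levyTail_antitone ρ hij)) hμ
      (fun i => htail (d i) (hd.pos i) (hd0 i))).neg
    -- Here 1 + g_n is the expected factor of one entry, and independence makes the mixed moment its
    -- n-th power.
    have hlim' := Real.tendsto_one_add_pow_exp_of_tendsto
      (g := fun n => -∫ x, (1 - ∏ i ∈ f.support, (if d i < x then z i else 1)) ∂(μ n))
      (hlim.congr fun n => by ring)
    refine hlim'.congr fun n => ?_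
    rw [integral_map (hZm n) hfc.aestronglyMeasurable]
    simp_rw [arrayCode_pow]
    have hwm : Measurable (fun x : ℝ => ∏ i ∈ f.support, (if d i < x then z i else 1)) :=
      Finset.measurable_fun_prod _ fun j _ =>
        Measurable.ite measurableSet_Ioi measurable_const measurable_const
    rw [(hind n).integral_fun_prod_comp
      (f := fun _ x => ∏ i ∈ f.support, (if d i < x then (1 / 2 : ℝ) ^ f i else 1))
      (fun j => (hX n j).aemeasurable) (fun j => hwm.aestronglyMeasurable)]
    have h4 : ∀ j, ∫ ω, ∏ i ∈ f.support, (if d i < X n j ω then (1 / 2 : ℝ) ^ f i else 1) ∂P =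
        ∫ x, ∏ i ∈ f.support, (if d i < x then z i else 1) ∂(μ n) := by
      intro j
      rw [← (hX n j).map_eq, integral_map (hX n j).aemeasurable hwm.aestronglyMeasurable]
    simp only [h4, Finset.prod_const, Finset.card_univ, Fintype.card_fin]
    congr 1
    rw [integral_sub (integrable_const _)]
    · simp
    · refine Integrable.of_bound (C := 1) hwm.aestronglyMeasurable (Eventually.of_forall fun x => ?_)
      have := prod_ite_mem_Icc f.support (fun j => d j < x) hz1
      rw [Real.norm_of_nonneg this.1]
      exact this.2
  · intro n
    exact aemeasurable_pi_lambda _ fun i => (measurable_orderStat (i + 1)).comp_aemeasurable (hXm n)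
  · exact aemeasurable_pi_lambda _ fun i =>
      (measurable_invLevyTail hρ).comp_aemeasurable (hG.aemeasurable (i + 1))
  · intro n
    filter_upwards [hXpos n] with ω hω
    exact levelCode_arrayCode hd hω
  -- Gamma laws are diffuse, so almost surely no point hits any of the countably many time levels,
  -- the ambiguous case of the inverse tail.
  · have hne : ∀ᵐ ω ∂P', ∀ i k, G (k + 1) ω ≠ t i := ae_all_iff.2 fun i => hG.ae_ne (t i)
    filter_upwards [hG.ae_monotone, hG.ae_pos, hne] with ω h1 h2 h3
    refine levelCode_pointsCode (fun a b hab => h1 (by omega)) (fun k => invLevyTail_nonneg ρ _)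
      fun k i => ?_
    exact invLevyTail_gt_iff hρ (hd.pos i).le (h2 k) (hfin i) (h3 i k)

/-! ## Triangular arrays with a common row law -/

section Array

variable {Ω Ω' : Type*} [MeasurableSpace Ω] [MeasurableSpace Ω'] {P : Measure Ω}
  {P' : Measure Ω'}

/-- The common law of the `n`-th row of a triangular array with identically distributed rows. -/
def arrayLaw (P : Measure Ω) (X : (n : ℕ) → Fin n → Ω → ℝ) (n : ℕ) : Measure ℝ :=
  if h : 0 < n then P.map (X n ⟨0, h⟩) else Measure.dirac 0

lemma hasLaw_arrayLaw {X : (n : ℕ) → Fin n → Ω → ℝ}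
    (h : ∀ n i j, IdentDistrib (X n i) (X n j) P P) (n : ℕ) (j : Fin n) :
    HasLaw (X n j) (arrayLaw P X n) P where
  aemeasurable := (h n j j).aemeasurable_fst
  map_eq := by
    have hn : 0 < n := j.pos
    rw [arrayLaw, dif_pos hn]
    exact (h n j _).map_eq

lemma isProbabilityMeasure_arrayLaw [IsProbabilityMeasure P] {X : (n : ℕ) → Fin n → Ω → ℝ}
    (h : ∀ n i j, IdentDistrib (X n i) (X n j) P P) (n : ℕ) :
    IsProbabilityMeasure (arrayLaw P X n) := by
  unfold arrayLaw
  split_ifs with hn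
  · exact Measure.isProbabilityMeasure_map (h n _ ⟨0, hn⟩).aemeasurable_fst
  · infer_instance

lemma arrayLaw_Iio {X : (n : ℕ) → Fin n → Ω → ℝ}
    (h : ∀ n i j, IdentDistrib (X n i) (X n j) P P) (h0 : ∀ n j, ∀ᵐ ω ∂P, 0 ≤ X n j ω) (n : ℕ) :
    arrayLaw P X n (Iio 0) = 0 := by
  unfold arrayLaw
  split_ifs with hn
  · rw [Measure.map_apply_of_aemeasurable (h n _ ⟨0, hn⟩).aemeasurable_fst measurableSet_Iio,
      measure_eq_zero_iff_ae_notMem]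
    filter_upwards [h0 n ⟨0, hn⟩] with ω hω
    simpa using hω
  · simp

/-- Union bound: if the k-th largest is at least ε, some entry exceeds ε/2. Halving passes from a
weak inequality to the strict one used by the tails. -/
theorem tendstoInMeasure_orderStat [IsProbabilityMeasure P] {X : (n : ℕ) → Fin n → Ω → ℝ}
    {μ : ℕ → Measure ℝ}
    (hX : ∀ n j, HasLaw (X n j) (μ n) P) (h0 : ∀ n j, ∀ᵐ ω ∂P, 0 ≤ X n j ω)
    (htail : ∀ x, 0 < x → Tendsto (fun n : ℕ => n * (μ n).real (Ioi x)) atTop (𝓝 0))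
    {k : ℕ} (hk : 1 ≤ k) :
    TendstoInMeasure P (fun n ω => orderStat (fun j => X n j ω) k) atTop (fun _ => 0) := by
  rw [tendstoInMeasure_iff_measureReal_norm]
  intro ε hε
  refine squeeze_zero (fun n => measureReal_nonneg) (fun n => ?_) (htail (ε / 2) (by positivity))
  have hpos : ∀ᵐ ω ∂P, ∀ j, 0 ≤ X n j ω := ae_all_iff.2 (h0 n)
  calc P.real {ω | ε ≤ ‖orderStat (fun j => X n j ω) k - 0‖}
      ≤ P.real (⋃ j : Fin n, {ω | ε / 2 < X n j ω}) := by
        refine ENNReal.toReal_mono (measure_ne_top _ _) (measure_mono_ae ?_)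
        filter_upwards [hpos] with ω hω hε'
        change ε ≤ ‖orderStat (fun j => X n j ω) k - 0‖ at hε'
        rw [sub_zero, Real.norm_of_nonneg (orderStat_nonneg hω k)] at hε'
        have h1 := (lt_orderStat_iff (fun j => X n j ω) hk (b := ε / 2) (by positivity)).1
          (by linarith)
        obtain ⟨j, hj⟩ := Finset.card_pos.1 (hk.trans h1)
        exact mem_iUnion.2 ⟨j, (Finset.mem_filter.1 hj).2⟩
    _ ≤ ∑ j : Fin n, P.real {ω | ε / 2 < X n j ω} := measureReal_iUnion_fintype_le _
    _ = n * (μ n).real (Ioi (ε / 2)) := by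
        have : ∀ j : Fin n, P.real {ω | ε / 2 < X n j ω} = (μ n).real (Ioi (ε / 2)) := fun j =>
          (hX n j).measureReal_eq measurableSet_Ioi
        simp [this]

lemma exists_isUnitPoissonPoints : ∃ Ω : Type, ∃ _ : MeasurableSpace Ω, ∃ P : Measure Ω,
    IsProbabilityMeasure P ∧ ∃ G : ℕ → Ω → ℝ, IsUnitPoissonPoints P G := by
  have : IsProbabilityMeasure (expMeasure 1) := isProbabilityMeasure_expMeasure one_pos
  obtain ⟨Ω, mΩ, P, E, -, hlaw, hind, hP⟩ := exists_iid ℕ (expMeasure 1)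
  have h : ∀ k, (fun ω => ∑ i ∈ Finset.range (k + 1), E i ω - ∑ i ∈ Finset.range k, E i ω) =
      E k := fun k => by
    ext ω
    rw [Finset.sum_range_succ, add_sub_cancel_left]
  refine ⟨Ω, mΩ, P, hP, fun k ω => ∑ i ∈ Finset.range k, E i ω, ?_, fun k => ?_, ?_⟩
  · exact Eventually.of_forall fun ω => by simp
  · rw [h k]
    exact hlaw k
  · rw [show (fun k ω => ∑ i ∈ Finset.range (k + 1), E i ω - ∑ i ∈ Finset.range k, E i ω) = E
      from funext h]
    exact hind

/-- Only the law of the limit matters: Poisson points on an auxiliary space supply a k-th point with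
the same Gamma law as `G`. -/
theorem tendstoInDistribution_orderStat_single [IsProbabilityMeasure P]
    [IsProbabilityMeasure P'] {ρ : Measure ℝ} (hρ : IsLevyMeasure ρ)
    {X : (n : ℕ) → Fin n → Ω → ℝ} {μ : ℕ → Measure ℝ}
    (hμ : ∀ n, IsProbabilityMeasure (μ n)) (hX : ∀ n j, HasLaw (X n j) (μ n) P)
    (hind : ∀ n, iIndepFun (X n) P) (hμ0 : ∀ n, μ n (Iio 0) = 0)
    (htail : ∀ x, 0 < x → ρ {x} = 0 →
      Tendsto (fun n : ℕ => n * (μ n).real (Ioi x)) atTop (𝓝 (levyTail ρ x).toReal))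
    {k : ℕ} (hk : 1 ≤ k) {G : Ω' → ℝ} (hG : HasLaw G (gammaMeasure k 1) P') :
    TendstoInDistribution (fun n ω => orderStat (fun j => X n j ω) k) atTop
      (fun ω => invLevyTail ρ (G ω)) (fun _ => P) P' := by
  obtain ⟨Ω'', mΩ'', P'', hP'', G'', hG''⟩ := exists_isUnitPoissonPoints
  -- The sequences start with the largest value at index 0, so the k-th largest is coordinate k - 1.
  have h := (tendstoInDistribution_orderStat hρ hμ hX hind hμ0 htail hG'').continuous_comp
    (continuous_apply (k - 1))
  have hk' : k - 1 + 1 = k := by omega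
  have hm := measurable_invLevyTail hρ
  have hlaw : P'.map (fun ω => invLevyTail ρ (G ω)) =
      P''.map (fun ω => invLevyTail ρ (G'' (k - 1 + 1) ω)) := by
    have h1 := AEMeasurable.map_map_of_aemeasurable (μ := P') (g := invLevyTail ρ) (f := G)
      hm.aemeasurable hG.aemeasurable
    have h2 := AEMeasurable.map_map_of_aemeasurable (μ := P'') (g := invLevyTail ρ)
      (f := G'' (k - 1 + 1)) hm.aemeasurable (hG''.aemeasurable _)
    rw [hG.map_eq] at h1
    rw [(hG''.hasLaw_gamma (k := k - 1 + 1) (by omega)).map_eq, hk'] at h2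
    rw [hk']
    exact h1.symm.trans h2
  have h3 : ∀ n, AEMeasurable (fun ω => orderStat (fun j => X n j ω) k) P := fun n =>
    (measurable_orderStat k).comp_aemeasurable
      (aemeasurable_pi_lambda _ fun j => (hX n j).aemeasurable)
  refine ⟨h3, hm.comp_aemeasurable hG.aemeasurable, ?_⟩
  have h4 := h.tendsto
  simp only [Function.comp_def, hk'] at h4 hlaw
  convert h4 using 2
  exact congrArg 𝓝 (Subtype.ext hlaw)

end Array

/-! ## Grouping independent variables in pairs -/

/-- Currying a product measure over ι × Bool gives a product over ι of two-fold products, which is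
independence of the pairs. -/
lemma ProbabilityTheory.iIndepFun.pairs {Ω ι : Type*} [Countable ι] [MeasurableSpace Ω]
    {P : Measure Ω} {X : ι × Bool → Ω → ℝ} (hX : ∀ p, AEMeasurable (X p) P) (h : iIndepFun X P)
    {g : ℝ → ℝ → ℝ} (hg : Measurable (Function.uncurry g)) :
    iIndepFun (fun j ω => g (X (j, false) ω) (X (j, true) ω)) P := by
  have := h.isProbabilityMeasure
  have hlawp : ∀ p, IsProbabilityMeasure (P.map (X p)) := fun p =>
    Measure.isProbabilityMeasure_map (hX p)
  have hvec : iIndepFun (fun (j : ι) ω (b : Bool) => X (j, b) ω) P := by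
    have hm : ∀ j, AEMeasurable (fun ω (b : Bool) => X (j, b) ω) P := fun j =>
      aemeasurable_pi_lambda _ fun b => hX (j, b)
    rw [iIndepFun_iff_map_fun_eq_infinitePi_map₀' hm]
    have h1 := (iIndepFun_iff_map_fun_eq_infinitePi_map₀' hX).1 h
    have h2 : ∀ j, P.map (fun ω (b : Bool) => X (j, b) ω) =
        Measure.infinitePi fun b => P.map (X (j, b)) := fun j =>
      (iIndepFun_iff_map_fun_eq_infinitePi_map₀' fun b => hX (j, b)).1
        (h.precomp (g := fun b : Bool => (j, b)) (fun _ _ hb => (Prod.mk.inj hb).2))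
    simp_rw [h2]
    rw [← Measure.infinitePi_map_curry (fun j b => P.map (X (j, b))), ← h1,
      AEMeasurable.map_map_of_aemeasurable (by fun_prop) (aemeasurable_pi_lambda _ hX)]
    rfl
  exact hvec.comp (fun _ v => g (v false) (v true)) fun _ =>
    Measurable.comp (f := fun v : Bool → ℝ => (v false, v true)) hg (by fun_prop)

/-! ## Multiplicative mixtures -/

/-- The image of `γ ⊗ m` under multiplication. -/
def mulMixture (γ m : Measure ℝ) : Measure ℝ := (γ.prod m).map (fun q => q.1 * q.2)

lemma mulMixture_apply {γ m : Measure ℝ} [SFinite m] {A : Set ℝ} (hA : MeasurableSet A) :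
    mulMixture γ m A = ∫⁻ x, m {w | x * w ∈ A} ∂γ := by
  have hm : Measurable (fun q : ℝ × ℝ => q.1 * q.2) := by fun_prop
  rw [mulMixture, Measure.map_apply hm hA, Measure.prod_apply (hm hA)]
  rfl

lemma mulMixture_Ioi {γ m : Measure ℝ} [SFinite m] (hγ : ∀ᵐ y ∂γ, 0 < y) (x : ℝ) :
    mulMixture γ m (Ioi x) = ∫⁻ y, levyTail m (x / y) ∂γ := by
  rw [mulMixture_apply measurableSet_Ioi]
  refine lintegral_congr_ae ?_
  filter_upwards [hγ] with y hy
  congr 1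
  ext w
  simp [div_lt_iff₀ hy, mul_comm]

lemma min_one_mul_le {y w : ℝ} (hy : 0 < y) (hw : 0 < w) :
    min 1 (y * w) ≤ (1 + y) * min 1 w := by
  rcases le_total 1 w with h | h
  · rw [min_eq_left h]
    exact (min_le_left _ _).trans (by linarith)
  · rw [min_eq_right h]
    exact (min_le_right _ _).trans (by nlinarith)

/-- The integrability comes from min(1, yw) ≤ (1 + y) min(1, w) together with the finite mean of γ.
-/
lemma IsLevyMeasure.mulMixture {γ ρ : Measure ℝ} [IsFiniteMeasure γ] (hρ : IsLevyMeasure ρ)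
    (hγ : ∀ᵐ y ∂γ, 0 < y) (hγi : Integrable (fun y => y) γ) :
    IsLevyMeasure (mulMixture γ ρ) where
  nonpos_null := by
    have := hρ.sigmaFinite
    rw [mulMixture_apply measurableSet_Iic]
    refine (lintegral_congr_ae (g := fun _ => 0) ?_).trans lintegral_zero
    filter_upwards [hγ] with y hy
    refine measure_mono_null (fun w hw => ?_) hρ.nonpos_null
    simp only [mem_ofPred_eq, mem_Iic] at hw ⊢
    by_contra! h
    nlinarith [mul_pos hy h]
  lintegral_lt_top := by
    have := hρ.sigmaFinite
    rw [_root_.mulMixture, lintegral_map (by fun_prop) (by fun_prop),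
      lintegral_prod _ (by fun_prop)]
    have h1 : ∫⁻ y, ∫⁻ w, ENNReal.ofReal (min 1 (y * w)) ∂ρ ∂γ ≤
        ∫⁻ y, ENNReal.ofReal (1 + y) * ∫⁻ w, ENNReal.ofReal (min 1 w) ∂ρ ∂γ := by
      refine lintegral_mono_ae ?_
      filter_upwards [hγ] with y hy
      rw [← lintegral_const_mul _ (by fun_prop)]
      refine lintegral_mono_ae ?_
      filter_upwards [hρ.ae_pos] with w hw
      rw [← ENNReal.ofReal_mul (by linarith)]
      exact ENNReal.ofReal_le_ofReal (min_one_mul_le hy hw)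
    refine h1.trans_lt ?_
    rw [lintegral_mul_const _ (by fun_prop)]
    refine ENNReal.mul_lt_top ?_ hρ.lintegral_lt_top
    exact ((integrable_const (1 : ℝ)).add hγi).lintegral_lt_top

lemma IsLevyMeasure.map_mul {ρ : Measure ℝ} (hρ : IsLevyMeasure ρ) {c : ℝ} (hc : 0 < c) :
    IsLevyMeasure (ρ.map (fun x => c * x)) where
  nonpos_null := by
    rw [Measure.map_apply (by fun_prop) measurableSet_Iic]
    refine measure_mono_null (fun w hw => ?_) hρ.nonpos_null
    simp only [mem_preimage, mem_Iic] at hw ⊢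
    by_contra! h
    nlinarith [mul_pos hc h]
  lintegral_lt_top := by
    rw [lintegral_map (by fun_prop) (by fun_prop)]
    have h1 : ∫⁻ w, ENNReal.ofReal (min 1 (c * w)) ∂ρ ≤
        ∫⁻ w, ENNReal.ofReal (1 + c) * ENNReal.ofReal (min 1 w) ∂ρ := by
      refine lintegral_mono_ae ?_
      filter_upwards [hρ.ae_pos] with w hw
      rw [← ENNReal.ofReal_mul (by linarith)]
      exact ENNReal.ofReal_le_ofReal (min_one_mul_le hc hw)
    refine h1.trans_lt ?_
    rw [lintegral_const_mul _ (by fun_prop)]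
    exact ENNReal.mul_lt_top ENNReal.ofReal_lt_top hρ.lintegral_lt_top

lemma map_mul_Ioi (m : Measure ℝ) {c : ℝ} (hc : 0 < c) (x : ℝ) :
    m.map (fun x => c * x) (Ioi x) = m (Ioi (x / c)) := by
  rw [Measure.map_apply (by fun_prop) measurableSet_Ioi]
  congr 1
  ext w
  simp [div_lt_iff₀ hc, mul_comm]

-- This moves the factor σ_v² into the Lévy measure, so that squared weights fall under the general
-- theorem on order statistics.
open Pointwise in
lemma invLevyTail_map_mul (ρ : Measure ℝ) {c : ℝ} (hc : 0 < c) (u : ℝ) :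
    invLevyTail (ρ.map (fun x => c * x)) u = c * invLevyTail ρ u := by
  have h : {x : ℝ | 0 < x ∧ levyTail (ρ.map (fun x => c * x)) x < ENNReal.ofReal u} =
      c • {x : ℝ | 0 < x ∧ levyTail ρ x < ENNReal.ofReal u} := by
    ext x
    simp only [levyTail, map_mul_Ioi ρ hc, mem_ofPred_eq, Set.mem_smul_set, smul_eq_mul]
    constructor
    · rintro ⟨h1, h2⟩
      exact ⟨x / c, ⟨div_pos h1 hc, h2⟩, mul_div_cancel₀ x hc.ne'⟩
    · rintro ⟨y, ⟨h1, h2⟩, rfl⟩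
      exact ⟨mul_pos hc h1, by rwa [mul_div_cancel_left₀ _ hc.ne']⟩
  rw [invLevyTail, h, Real.sInf_smul_of_nonneg hc.le, smul_eq_mul, invLevyTail]

lemma mulMixture_map_mul {γ m : Measure ℝ} [SFinite γ] [SFinite m] (c : ℝ) :
    mulMixture (γ.map (fun x => c * x)) m = (mulMixture γ m).map (fun x => c * x) := by
  have h : (γ.map (fun x => c * x)).prod m = (γ.prod m).map (Prod.map (fun x => c * x) id) := by
    rw [← Measure.map_prod_map _ _ (by fun_prop) measurable_id, Measure.map_id]
  rw [mulMixture, mulMixture, h, Measure.map_map (by fun_prop) (by fun_prop),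
    Measure.map_map (by fun_prop) (by fun_prop)]
  congr 1
  ext q
  simp [mul_assoc]

/-- Uniform bound on rescaled tails from convergence of the Laplace exponents at one. -/
lemma exists_tail_bound {μ : ℕ → Measure ℝ} (hμ : ∀ n, IsProbabilityMeasure (μ n))
    (hμ0 : ∀ n, μ n (Iio 0) = 0) {c : ℝ}
    (h : Tendsto (fun n : ℕ => n * ∫ x, (1 - Real.exp (-(x * (1 : ℕ)))) ∂(μ n)) atTop (𝓝 c)) :
    ∃ C, 0 ≤ C ∧ ∀ n : ℕ, ∀ u, 0 < u → n * (μ n).real (Ioi u) ≤ C * (1 + 1 / u) := by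
  obtain ⟨C, hC⟩ := h.bddAbove_range
  refine ⟨max C 0, le_max_right _ _, fun n u hu => ?_⟩
  have hCn : n * ∫ x, (1 - Real.exp (-(x * (1 : ℕ)))) ∂(μ n) ≤ C := hC ⟨n, rfl⟩
  have hμpos : ∀ᵐ y ∂(μ n), 0 ≤ y := by
    have : ∀ᵐ y ∂(μ n), y ∉ Iio 0 := measure_eq_zero_iff_ae_notMem.1 (hμ0 n)
    filter_upwards [this] with y hy using not_lt.1 hy
  have hpos : 0 < 1 - Real.exp (-u) := by
    have : Real.exp (-u) < 1 := by
      rw [← Real.exp_zero]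
      exact Real.exp_lt_exp.2 (by linarith)
    linarith
  have h0 : 0 ≤ᵐ[μ n] fun x => 1 - Real.exp (-(x * (1 : ℕ))) := by
    filter_upwards [hμpos] with y hy
    have : Real.exp (-(y * (1 : ℕ))) ≤ 1 := Real.exp_le_one_iff.2 (by simpa using hy)
    simpa using this
  have hint : Integrable (fun x => 1 - Real.exp (-(x * (1 : ℕ)))) (μ n) := by
    refine Integrable.of_bound (C := 1) (by fun_prop) ?_
    filter_upwards [h0] with y hy
    rw [Real.norm_of_nonneg hy]
    linarith [Real.exp_pos (-(y * (1 : ℕ)))]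
  have hmark := mul_meas_ge_le_integral_of_nonneg h0 hint (1 - Real.exp (-u))
  have hmono : (μ n).real (Ioi u) ≤
      (μ n).real {x | 1 - Real.exp (-u) ≤ 1 - Real.exp (-(x * (1 : ℕ)))} := by
    refine measureReal_mono fun x hx => ?_
    have : Real.exp (-x) ≤ Real.exp (-u) := Real.exp_le_exp.2 (by linarith [mem_Ioi.1 hx])
    rw [mem_ofPred_eq, Nat.cast_one, mul_one]
    linarith
  -- Since 1 - e^{-u} ≥ u/(1+u), its reciprocal is at most 1 + 1/u; Markov's inequality for 1 -
  -- e^{-x} then yields the bound.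
  have hinv : 1 ≤ (1 - Real.exp (-u)) * (1 + 1 / u) := by
    have h1 : Real.exp (-u) ≤ 1 / (1 + u) := by
      rw [Real.exp_neg, ← one_div]
      exact one_div_le_one_div_of_le (by linarith) (by linarith [Real.add_one_le_exp u])
    have h2 : 1 = (1 - 1 / (1 + u)) * (1 + 1 / u) := by
      field_simp
      ring
    calc (1 : ℝ) = (1 - 1 / (1 + u)) * (1 + 1 / u) := h2
      _ ≤ (1 - Real.exp (-u)) * (1 + 1 / u) := by gcongr
  have hb0 : 0 ≤ (μ n).real (Ioi u) := measureReal_nonneg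
  have hn0 : (0 : ℝ) ≤ n := Nat.cast_nonneg n
  have hu' : 0 < 1 + 1 / u := by positivity
  calc n * (μ n).real (Ioi u) ≤ n * (μ n).real (Ioi u) * ((1 - Real.exp (-u)) * (1 + 1 / u)) :=
        le_mul_of_one_le_right (by positivity) hinv
    _ = (n * ((1 - Real.exp (-u)) * (μ n).real (Ioi u))) * (1 + 1 / u) := by ring
    _ ≤ (n * ∫ x, (1 - Real.exp (-(x * (1 : ℕ)))) ∂(μ n)) * (1 + 1 / u) := by
        gcongr
        exact (mul_le_mul_of_nonneg_left hmono hpos.le).trans hmark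
    _ ≤ max C 0 * (1 + 1 / u) := by
        gcongr
        exact hCn.trans (le_max_left _ _)

/-- Convergence of rescaled tails is preserved by multiplicative mixing with a diffuse law on
`(0, ∞)` with finite mean. -/
theorem tendsto_tail_mulMixture {γ ρ : Measure ℝ} [IsProbabilityMeasure γ] (hρ : IsLevyMeasure ρ)
    (hγ : ∀ᵐ y ∂γ, 0 < y) (hγi : Integrable (fun y => y) γ) (hγ0 : ∀ y, γ {y} = 0)
    {μ : ℕ → Measure ℝ} (hμ : ∀ n, IsProbabilityMeasure (μ n)) {C : ℝ}
    (hC : ∀ n : ℕ, ∀ u, 0 < u → n * (μ n).real (Ioi u) ≤ C * (1 + 1 / u))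
    (htail : ∀ x, 0 < x → ρ {x} = 0 →
      Tendsto (fun n : ℕ => n * (μ n).real (Ioi x)) atTop (𝓝 (levyTail ρ x).toReal))
    {x : ℝ} (hx : 0 < x) :
    Tendsto (fun n : ℕ => n * (mulMixture γ (μ n)).real (Ioi x)) atTop
      (𝓝 (levyTail (mulMixture γ ρ) x).toReal) := by
  have := hρ.sigmaFinite
  have hmeas : ∀ m : Measure ℝ, Measurable (fun y : ℝ => levyTail m (x / y)) := fun m =>
    (levyTail_antitone m).measurable.comp (measurable_const.div measurable_id)
  have hn : ∀ n : ℕ, n * (mulMixture γ (μ n)).real (Ioi x) =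
      ∫ y, n * (μ n).real (Ioi (x / y)) ∂γ := by
    intro n
    rw [integral_const_mul, measureReal_def, mulMixture_Ioi hγ, ← integral_toReal
      (hmeas _).aemeasurable (Eventually.of_forall fun y => measure_lt_top _ _)]
    rfl
  have h0 : (levyTail (mulMixture γ ρ) x).toReal = ∫ y, (levyTail ρ (x / y)).toReal ∂γ := by
    rw [levyTail, mulMixture_Ioi hγ, integral_toReal (hmeas _).aemeasurable]
    filter_upwards [hγ] with y hy using hρ.levyTail_lt_top (div_pos hx hy)
  simp_rw [hn, h0]
  -- The tail bound at x/y becomes C(1 + y/x), integrable because γ has finite mean.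
  refine tendsto_integral_of_dominated_convergence (fun y => C * (1 + y / x)) (fun n => ?_)
    (((integrable_const (1 : ℝ)).add (hγi.div_const x)).const_mul C) (fun n => ?_) ?_
  · exact (((hmeas (μ n)).ennreal_toReal).const_mul _).aestronglyMeasurable
  · filter_upwards [hγ] with y hy
    rw [Real.norm_of_nonneg (by positivity)]
    have := hC n (x / y) (div_pos hx hy)
    rwa [one_div_div] at this
  -- Convergence is in doubt only for those y with x/y an atom of ρ. They form a countable, hence
  -- γ-null set, so every x > 0 is allowed.
  · have hcount : {a : ℝ | 0 < ρ {a}}.Countable :=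
      Measure.countable_meas_level_set_pos (μ := ρ) measurable_id
    have hnull : γ ((fun a => x / a) '' {a : ℝ | 0 < ρ {a}}) = 0 := by
      rw [← biUnion_of_singleton ((fun a => x / a) '' {a : ℝ | 0 < ρ {a}}),
        measure_biUnion_null_iff (hcount.image _)]
      exact fun y _ => hγ0 y
    filter_upwards [hγ, measure_eq_zero_iff_ae_notMem.1 hnull] with y hy hy'
    refine htail _ (div_pos hx hy) ?_
    by_contra hne
    exact hy' ⟨x / y, pos_iff_ne_zero.2 hne, by field_simp⟩

/-! ## The square of a Gaussian variable -/

lemma gaussianReal_map_sq :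
    (gaussianReal 0 1).map (fun x => x ^ 2) = gammaMeasure (1 / 2) (1 / 2) := by
  have hgm : Measurable (gammaPDF (1 / 2) (1 / 2)) :=
    (measurable_gammaPDFReal (1 / 2) (1 / 2)).ennreal_ofReal
  refine Measure.ext_of_lintegral _ fun f hf => ?_
  rw [lintegral_map hf (by fun_prop), gaussianReal_of_var_ne_zero 0 one_ne_zero,
    lintegral_withDensity_eq_lintegral_mul _ (measurable_gaussianPDF 0 1) (by fun_prop),
    gammaMeasure, lintegral_withDensity_eq_lintegral_mul _ hgm hf]
  simp only [Pi.mul_apply]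
  set I := ∫⁻ y in Ioi (0 : ℝ), gammaPDF (1 / 2) (1 / 2) y * f y with hI
  have hdens : ∀ x : ℝ, x ≠ 0 → ENNReal.ofReal |2 * x| * gammaPDF (1 / 2) (1 / 2) (x ^ 2) =
      2 * gaussianPDF 0 1 x := by
    intro x hx
    have hx2 : 0 < |x| := abs_pos.2 hx
    rw [gammaPDF_of_nonneg (sq_nonneg x), gaussianPDF, ← ENNReal.ofReal_mul (abs_nonneg _),
      show (2 : ℝ≥0∞) = ENNReal.ofReal 2 by simp, ← ENNReal.ofReal_mul (by norm_num)]
    congr 1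
    rw [Real.Gamma_one_half_eq, gaussianPDFReal, ← sq_abs x,
      show (1 / 2 : ℝ) - 1 = -(1 / 2) by norm_num, Real.rpow_neg (sq_nonneg _),
      ← Real.sqrt_eq_rpow, ← Real.sqrt_eq_rpow, Real.sqrt_sq hx2.le, abs_mul, abs_two]
    simp only [NNReal.coe_one, mul_one, sub_zero]
    rw [one_div, Real.sqrt_inv, Real.sqrt_mul (by norm_num : (0 : ℝ) ≤ 2), sq_abs]
    have h1 : Real.sqrt 2 ≠ 0 := by positivity
    have h2 : Real.sqrt Real.pi ≠ 0 := by positivity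
    have h3 : -(2⁻¹ * x ^ 2) = -x ^ 2 / 2 := by ring
    rw [h3]
    field_simp
  -- Squaring maps each open half-line bijectively onto (0, ∞), and each carries half of the Gamma
  -- integral. Keeping the factor 2 avoids division in `ℝ≥0∞`.
  have hhalf : ∀ s : Set ℝ, MeasurableSet s → (∀ x ∈ s, x ≠ 0) → InjOn (fun x : ℝ => x ^ 2) s →
      (fun x : ℝ => x ^ 2) '' s = Ioi 0 →
      2 * ∫⁻ x in s, gaussianPDF 0 1 x * f (x ^ 2) = I := by
    intro s hs hs0 hinj himg
    have h := lintegral_image_eq_lintegral_abs_deriv_mul hs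
      (f := fun x : ℝ => x ^ 2) (f' := fun x => 2 * x)
      (fun x _ => by simpa using (hasDerivAt_pow 2 x).hasDerivWithinAt) hinj
      (fun y => gammaPDF (1 / 2) (1 / 2) y * f y)
    rw [himg] at h
    rw [hI, h, ← lintegral_const_mul _ (by have := measurable_gaussianPDF 0 1; fun_prop)]
    refine setLIntegral_congr_fun hs fun x hx => ?_
    rw [← mul_assoc, ← mul_assoc, hdens x (hs0 x hx)]
  have hp := hhalf (Ioi 0) measurableSet_Ioi (fun x hx => (mem_Ioi.1 hx).ne')
    (fun x hx y hy hxy => by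
      have h1 := mem_Ioi.1 hx
      have h2 := mem_Ioi.1 hy
      simp only at hxy
      nlinarith [sq_eq_sq₀ h1.le h2.le |>.1 hxy])
    (by
      ext y
      simp only [mem_image, mem_Ioi]
      constructor
      · rintro ⟨x, hx, rfl⟩
        positivity
      · intro hy
        exact ⟨√y, Real.sqrt_pos.2 hy, Real.sq_sqrt hy.le⟩)
  have hn := hhalf (Iio 0) measurableSet_Iio (fun x hx => (mem_Iio.1 hx).ne)
    (fun x hx y hy hxy => by
      have h1 := mem_Iio.1 hx
      have h2 := mem_Iio.1 hy
      simp only at hxy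
      have h3 : (-x) ^ 2 = (-y) ^ 2 := by simpa using hxy
      have := (sq_eq_sq₀ (by linarith) (by linarith)).1 h3
      linarith)
    (by
      ext y
      simp only [mem_image, mem_Iio, mem_Ioi]
      constructor
      · rintro ⟨x, hx, rfl⟩
        exact sq_pos_of_neg hx
      · intro hy
        exact ⟨-√y, by simpa using hy, by rw [neg_sq, Real.sq_sqrt hy.le]⟩)
  have hsplit : ∀ F : ℝ → ℝ≥0∞, ∫⁻ x, F x = (∫⁻ x in Iio 0, F x) + ∫⁻ x in Ioi 0, F x := by
    intro F
    rw [← lintegral_add_compl F (measurableSet_Iio (a := (0 : ℝ))), compl_Iio,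
      setLIntegral_congr Ioi_ae_eq_Ici.symm]
  have hgam0 : ∫⁻ y in Iio (0 : ℝ), gammaPDF (1 / 2) (1 / 2) y * f y = 0 := by
    rw [setLIntegral_congr_fun (g := fun _ => 0) measurableSet_Iio
      (fun y hy => by simp [gammaPDF_of_neg hy]), lintegral_zero]
  rw [hsplit, hsplit (fun y => gammaPDF (1 / 2) (1 / 2) y * f y), hgam0, zero_add, ← hI]
  refine (ENNReal.mul_right_inj two_ne_zero ENNReal.ofNat_ne_top).1 ?_
  rw [mul_add, hp, hn, two_mul]

lemma gaussianReal_map_sq_of_pos {σ : ℝ} :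
    (gaussianReal 0 (Real.toNNReal (σ ^ 2))).map (fun x => x ^ 2) =
      (gammaMeasure (1 / 2) (1 / 2)).map (fun x => σ ^ 2 * x) := by
  have h := gaussianReal_map_const_mul (μ := 0) (v := 1) σ
  rw [mul_zero, mul_one] at h
  have h2 : NNReal.mk (σ ^ 2) (sq_nonneg σ) = Real.toNNReal (σ ^ 2) := by
    ext
    simp [sq_nonneg]
  rw [h2] at h
  rw [← h, ← gaussianReal_map_sq, Measure.map_map (by fun_prop) (by fun_prop),
    Measure.map_map (by fun_prop) (by fun_prop)]
  congr 1
  ext x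
  simp [mul_pow]

lemma integrable_id_gammaMeasure_half : Integrable (fun y => y) (gammaMeasure (1 / 2) (1 / 2)) := by
  rw [← gaussianReal_map_sq, integrable_map_measure (by fun_prop) (by fun_prop)]
  exact (memLp_id_gaussianReal (μ := 0) (v := 1) 2).integrable_sq

/-! ## The limit variables -/

lemma poissonSum_lt_one (k : ℕ) {y : ℝ} (hy : 0 < y) : poissonSum k y < 1 := by
  have h1 : ∑ i ∈ Finset.range k, y ^ i / (i.factorial : ℝ) < Real.exp y := by
    have h2 := Real.sum_le_exp_of_nonneg hy.le (k + 1)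
    rw [Finset.sum_range_succ] at h2
    have h3 : 0 < y ^ k / (k.factorial : ℝ) := by positivity
    linarith
  calc poissonSum k y < Real.exp (-y) * Real.exp y :=
        mul_lt_mul_of_pos_left h1 (Real.exp_pos _)
    _ = 1 := by rw [← Real.exp_add, neg_add_cancel, Real.exp_zero]

lemma levyTail_zero_pos {ρ : Measure ℝ} (hρ : IsLevyMeasure ρ) (h0 : ρ ≠ 0) :
    0 < levyTail ρ 0 := by
  refine pos_iff_ne_zero.2 fun h => h0 (Measure.measure_univ_eq_zero.1 ?_)
  rw [← Iic_union_Ioi (a := (0 : ℝ))]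
  exact measure_union_null hρ.nonpos_null h

section LimitVariable

variable {Ω : Type*} [MeasurableSpace Ω] {P : Measure Ω} {ρ : Measure ℝ} {k : ℕ} {G : Ω → ℝ}

/-- Almost surely the event is that `G` exceeds the tail at x, whose probability is the Gamma tail.
Right-continuity of the tail makes this valid at atoms as well. -/
lemma measureReal_invLevyTail_le (hρ : IsLevyMeasure ρ)
    (hk : 1 ≤ k) (hG : HasLaw G (gammaMeasure k 1) P) {x : ℝ} (hx : 0 ≤ x)
    (hfin : levyTail ρ x < ∞) :
    P.real {ω | invLevyTail ρ (G ω) ≤ x} = poissonSum k (levyTail ρ x).toReal := by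
  have hy : 0 ≤ (levyTail ρ x).toReal := ENNReal.toReal_nonneg
  rw [← gammaMeasure_real_Ioi hk hy]
  refine Eq.trans (measureReal_congr ?_) (hG.measureReal_eq measurableSet_Ioi)
  have hpos := (hG.ae_iff (p := fun g => 0 < g) (by fun_prop)).2 (gammaMeasure_ae_pos k 1)
  have hne := (hG.ae_iff (p := fun g => g ≠ (levyTail ρ x).toReal)
    (measurableSet_setOfPred.1 (measurableSet_singleton _).compl)).2
    (measure_eq_zero_iff_ae_notMem.1 (gammaMeasure_singleton k 1 _))
  filter_upwards [hpos, hne] with ω h1 h2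
  refine propext ?_
  change invLevyTail ρ (G ω) ≤ x ↔ (levyTail ρ x).toReal < G ω
  rw [← not_lt, invLevyTail_gt_iff hρ hx h1 hfin.ne h2, not_lt]
  exact ⟨fun h => lt_of_le_of_ne h h2.symm, le_of_lt⟩

lemma measureReal_invLevyTail_le_zero (hρ : IsLevyMeasure ρ)
    (hG : HasLaw G (gammaMeasure k 1) P) (hinf : levyTail ρ 0 = ∞) :
    P.real {ω | invLevyTail ρ (G ω) ≤ 0} = 0 := by
  have hpos := (hG.ae_iff (p := fun g => 0 < g) (by fun_prop)).2 (gammaMeasure_ae_pos k 1)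
  rw [measureReal_def, measure_eq_zero_iff_ae_notMem.2, ENNReal.toReal_zero]
  filter_upwards [hpos] with ω h1 h2
  exact absurd (lt_invLevyTail hρ h1 (hinf ▸ ENNReal.ofReal_lt_top)) (not_lt.2 h2)

lemma not_ae_invLevyTail_eq_zero [IsProbabilityMeasure P] (hρ : IsLevyMeasure ρ) (h0 : ρ ≠ 0)
    (hk : 1 ≤ k) (hG : HasLaw G (gammaMeasure k 1) P) :
    ¬ ∀ᵐ ω ∂P, invLevyTail ρ (G ω) = 0 := by
  intro h
  have h1 : P.real {ω | invLevyTail ρ (G ω) ≤ 0} = 1 := by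
    rw [measureReal_congr (t := univ), probReal_univ]
    filter_upwards [h] with ω hω
    exact propext (iff_of_true hω.le trivial)
  rcases eq_or_ne (levyTail ρ 0) ∞ with hinf | hfin
  · rw [measureReal_invLevyTail_le_zero hρ hG hinf] at h1
    exact zero_ne_one h1
  · rw [measureReal_invLevyTail_le hρ hk hG le_rfl hfin.lt_top] at h1
    exact (poissonSum_lt_one k
      (ENNReal.toReal_pos (levyTail_zero_pos hρ h0).ne' hfin)).ne h1

end LimitVariable

/-! ## Tails of infinitesimal arrays -/

section Array

variable {Ω : Type*} [MeasurableSpace Ω] {P : Measure Ω} [IsProbabilityMeasure P]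
  {X : (n : ℕ) → Fin n → Ω → ℝ} {a : ℝ} {ρ : Measure ℝ}

lemma tendsto_tail_arrayLaw (ha : 0 ≤ a) (hρ : IsLevyMeasure ρ)
    (hind : ∀ n, iIndepFun (X n) P) (hid : ∀ n i j, IdentDistrib (X n i) (X n j) P P)
    (h0 : ∀ n j, ∀ᵐ ω ∂P, 0 ≤ X n j ω)
    (hlim : TendstoID P (fun n ω => ∑ j, X n j ω) a ρ) {x : ℝ} (hx : 0 < x) (hx0 : ρ {x} = 0) :
    Tendsto (fun n : ℕ => n * (arrayLaw P X n).real (Ioi x)) atTop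
      (𝓝 (levyTail ρ x).toReal) := by
  have hμ := isProbabilityMeasure_arrayLaw hid
  exact tendsto_tail_of_tendsto_laplaceExponent ha hρ (fun n => inferInstance)
    (arrayLaw_Iio hid h0) (tendsto_laplaceExponent hμ (hasLaw_arrayLaw hid) hind
      (arrayLaw_Iio hid h0) hlim) hx hx0

end Array

lemma tendsto_tail_zero {u : ℝ → ℕ → ℝ} {ρ : Measure ℝ} (h0 : ρ = 0)
    (h : ∀ x, 0 < x → ρ {x} = 0 → Tendsto (u x) atTop (𝓝 (levyTail ρ x).toReal)) :
    ∀ x, 0 < x → Tendsto (u x) atTop (𝓝 0) := fun x hx => by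
  simpa [levyTail, h0] using h x hx (by simp [h0])

/-- Mixing with a probability measure preserves the total mass. -/
lemma gammaMixture_eq_zero_iff {ρ : Measure ℝ} (hρ : IsLevyMeasure ρ) :
    gammaMixture ρ = 0 ↔ ρ = 0 := by
  have : IsProbabilityMeasure (gammaMeasure (1 / 2) (1 / 2)) :=
    isProbabilityMeasure_gammaMeasure (by norm_num) (by norm_num)
  rw [← Measure.measure_univ_eq_zero, ← Measure.measure_univ_eq_zero (μ := ρ),
    gammaMixture_apply hρ MeasurableSet.univ]
  simp only [mem_univ, ofPred_true, lintegral_const, measure_univ, mul_one]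

/-! ## Node variances and incoming weights of a network -/

namespace ScaleMixtureNetwork

variable {Ω : Type*} [MeasurableSpace Ω] {P : Measure Ω} {L din dout : ℕ} {σb σv : ℝ}
  (N : ScaleMixtureNetwork P L din dout σb σv) {l : ℕ}

lemma layerWidth_of_le (p : ℕ → ℕ) (hl : 1 ≤ l) (hlL : l ≤ L) :
    layerWidth L din dout p l = p l := by
  rw [layerWidth, if_neg (by omega), if_pos hlL]

lemma lt_layerWidth_succ {p : ℕ → ℕ} {m : ℕ} (hp : m < p (l + 1)) (hlL : l ≤ L)
    (hm : l = L → m < dout) : m < layerWidth L din dout p (l + 1) := by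
  rw [layerWidth, if_neg (by omega)]
  split_ifs with h
  · exact hp
  · exact hm (by omega)

lemma lam_cast {n n' : ℕ} (h : n = n') (j : Fin n) : N.lam l n' (Fin.cast h j) = N.lam l n j := by
  subst h
  rfl

lemma iIndepFun_lam [IsProbabilityMeasure P] (hl : 1 ≤ l) (hlL : l ≤ L) (n : ℕ) :
    iIndepFun (N.lam l n) P := by
  -- Width 0 is not an admissible network width, but then the family is empty.
  rcases Nat.eq_zero_or_pos n with rfl | hn
  · exact iIndepFun.of_subsingleton
  have hw : n = layerWidth L din dout (fun _ => n) l := by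
    rw [layerWidth_of_le _ hl hlL]
  have h := (N.indep (fun _ => n) fun _ => hn).precomp
    (g := fun j : Fin n => ParamIndex.nodeVar ⟨l, by omega⟩ (Fin.cast hw j))
    (fun i j hij => by simpa using hij)
  convert h using 2 with j
  exact (N.lam_cast hw j).symm

variable {m : ℕ}

/-- Laws are given only through admissible width sequences. Here layer l gets width n and every
other hidden layer m + 1, so that node m exists at layer l + 1; for the output layer this is what
`hm` provides. -/
lemma V_hasLaw (hl : 1 ≤ l) (hlL : l ≤ L) (hm : l = L → m < dout) {n : ℕ} (j : Fin n) :
    HasLaw (N.V (l + 1) j m) (gaussianReal 0 (Real.toNNReal (σv ^ 2))) P := by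
  have hw : n = layerWidth L din dout (fun l' => if l' = l then n else m + 1) l := by
    rw [layerWidth_of_le _ hl hlL, if_pos rfl]
  have hm' : m < layerWidth L din dout (fun l' => if l' = l then n else m + 1) (l + 1) :=
    lt_layerWidth_succ (by simp) hlL hm
  refine N.V_law _ (fun l' => ?_) ⟨l, by omega⟩ (Fin.cast hw j) ⟨m, hm'⟩
  have := j.pos
  split_ifs <;> omega

lemma iIndepFun_lam_V [IsProbabilityMeasure P] (hl : 1 ≤ l) (hlL : l ≤ L)
    (hm : l = L → m < dout) (n : ℕ) :
    iIndepFun (fun (q : Fin n × Bool) ω =>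
      bif q.2 then N.V (l + 1) q.1 m ω else N.lam l n q.1 ω) P := by
  rcases Nat.eq_zero_or_pos n with rfl | hn
  · exact iIndepFun.of_subsingleton
  have hw : n = layerWidth L din dout (fun l' => if l' = l then n else m + 1) l := by
    rw [layerWidth_of_le _ hl hlL, if_pos rfl]
  have hm' : m < layerWidth L din dout (fun l' => if l' = l then n else m + 1) (l + 1) :=
    lt_layerWidth_succ (by simp) hlL hm
  have h := (N.indep (fun l' => if l' = l then n else m + 1)
    fun l' => by split_ifs <;> omega).precomp
    (g := fun q : Fin n × Bool => bif q.2 then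
      ParamIndex.weight ⟨l, by omega⟩ (Fin.cast hw q.1) ⟨m, hm'⟩
      else ParamIndex.nodeVar ⟨l, by omega⟩ (Fin.cast hw q.1))
    (by
      rintro ⟨i, b⟩ ⟨j, c⟩ hij
      cases b <;> cases c
      · have : i = j := by simpa using hij
        rw [this]
      · simp at hij
      · simp at hij
      · have : i = j := by simpa using hij
        rw [this])
  convert h using 2 with q
  obtain ⟨j, b⟩ := q
  cases b
  · exact (N.lam_cast hw j).symm
  · rfl

lemma lam_hasLaw (hl : 1 ≤ l) (hlL : l ≤ L) {n : ℕ} (j : Fin n) :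
    HasLaw (N.lam l n j) (N.μ l n) P :=
  N.lam_law l n j hl hlL j.pos

lemma identDistrib_lam (hl : 1 ≤ l) (hlL : l ≤ L) (n : ℕ) (i j : Fin n) :
    IdentDistrib (N.lam l n i) (N.lam l n j) P P where
  aemeasurable_fst := (N.lam_hasLaw hl hlL i).aemeasurable
  aemeasurable_snd := (N.lam_hasLaw hl hlL j).aemeasurable
  map_eq := by rw [(N.lam_hasLaw hl hlL i).map_eq, (N.lam_hasLaw hl hlL j).map_eq]

lemma lam_nonneg (hl : 1 ≤ l) (hlL : l ≤ L) (n : ℕ) (j : Fin n) : ∀ᵐ ω ∂P, 0 ≤ N.lam l n j ω := by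
  refine ((N.lam_hasLaw hl hlL j).ae_iff (p := fun x => 0 ≤ x) (by fun_prop)).2 ?_
  filter_upwards [measure_eq_zero_iff_ae_notMem.1 (N.μ_neg_null l n hl hlL j.pos)] with x hx
  exact not_lt.1 hx

lemma iIndepFun_sq_W [IsProbabilityMeasure P] (hl : 1 ≤ l) (hlL : l ≤ L)
    (hm : l = L → m < dout) (n : ℕ) : iIndepFun (fun j ω => N.W l n j m ω ^ 2) P := by
  refine iIndepFun.pairs ?_ (N.iIndepFun_lam_V hl hlL hm n) (g := fun x y => (√x * y) ^ 2)
    (by unfold Function.uncurry; fun_prop)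
  rintro ⟨j, b⟩
  cases b
  · exact (N.lam_hasLaw hl hlL j).aemeasurable
  · exact (N.V_hasLaw hl hlL hm j).aemeasurable

/-- Since λ ≥ 0 almost surely, W² = V²λ with independent factors, and V² is σ_v² times a Gamma(1/2,
1/2) variable. The scaling is pulled out of the mixture. -/
lemma hasLaw_sq_W [IsProbabilityMeasure P] (hl : 1 ≤ l) (hlL : l ≤ L)
    (hm : l = L → m < dout) (n : ℕ) (j : Fin n) :
    HasLaw (fun ω => N.W l n j m ω ^ 2)
      ((mulMixture (gammaMeasure (1 / 2) (1 / 2)) (arrayLaw P (N.lam l) n)).map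
        (fun x => σv ^ 2 * x)) P := by
  have hlam := hasLaw_arrayLaw (N.identDistrib_lam hl hlL) n j
  have hV := N.V_hasLaw hl hlL hm j
  have := isProbabilityMeasure_arrayLaw (N.identDistrib_lam hl hlL) n
  have : IsProbabilityMeasure (gammaMeasure (1 / 2) (1 / 2)) :=
    isProbabilityMeasure_gammaMeasure (by norm_num) (by norm_num)
  have hind : IndepFun (N.V (l + 1) j m) (N.lam l n j) P :=
    (N.iIndepFun_lam_V hl hlL hm n).indepFun (i := (j, true)) (j := (j, false)) (by simp)
  have hind2 : IndepFun (fun ω => N.V (l + 1) j m ω ^ 2) (N.lam l n j) P :=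
    hind.comp (φ := fun x => x ^ 2) (ψ := id) (by fun_prop) measurable_id
  have hVm : AEMeasurable (fun ω => N.V (l + 1) j m ω ^ 2) P := hV.aemeasurable.pow_const 2
  have hVlaw : P.map (fun ω => N.V (l + 1) j m ω ^ 2) =
      (gammaMeasure (1 / 2) (1 / 2)).map (fun x => σv ^ 2 * x) := by
    rw [← gaussianReal_map_sq_of_pos, ← hV.map_eq,
      AEMeasurable.map_map_of_aemeasurable (by fun_prop) hV.aemeasurable]
    rfl
  have hprod : HasLaw (fun ω => N.V (l + 1) j m ω ^ 2 * N.lam l n j ω)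
      ((mulMixture (gammaMeasure (1 / 2) (1 / 2)) (arrayLaw P (N.lam l) n)).map
        (fun x => σv ^ 2 * x)) P := by
    refine ⟨hVm.mul hlam.aemeasurable, ?_⟩
    rw [← mulMixture_map_mul, ← hVlaw, ← hlam.map_eq, mulMixture,
      ← (indepFun_iff_map_prod_eq_prod_map_map hVm hlam.aemeasurable).1 hind2,
      AEMeasurable.map_map_of_aemeasurable (by fun_prop) (hVm.prodMk hlam.aemeasurable)]
    rfl
  refine hprod.congr ?_
  filter_upwards [N.lam_nonneg hl hlL n j] with ω hω
  rw [W, mul_pow, Real.sq_sqrt hω, mul_comm]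

variable {a : ℝ} {ρ : Measure ℝ}

lemma tendsto_tail_sq_W [IsProbabilityMeasure P] (ha : 0 ≤ a) (hρ : IsLevyMeasure ρ)
    (hσ : 0 < σv) (hl : 1 ≤ l) (hlL : l ≤ L)
    (hlim : TendstoID P (fun n ω => ∑ j, N.lam l n j ω) a ρ) {x : ℝ} (hx : 0 < x) :
    Tendsto (fun n : ℕ => n * ((mulMixture (gammaMeasure (1 / 2) (1 / 2))
        (arrayLaw P (N.lam l) n)).map (fun x => σv ^ 2 * x)).real (Ioi x)) atTop
      (𝓝 (levyTail ((gammaMixture ρ).map (fun x => σv ^ 2 * x)) x).toReal) := by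
  have : IsProbabilityMeasure (gammaMeasure (1 / 2) (1 / 2)) :=
    isProbabilityMeasure_gammaMeasure (by norm_num) (by norm_num)
  have hid := N.identDistrib_lam hl hlL
  have h0 := N.lam_nonneg hl hlL
  have hind := N.iIndepFun_lam hl hlL
  have hσ2 : 0 < σv ^ 2 := by positivity
  obtain ⟨C, -, hC⟩ := exists_tail_bound (isProbabilityMeasure_arrayLaw hid)
    (arrayLaw_Iio hid h0) (tendsto_laplaceExponent (isProbabilityMeasure_arrayLaw hid)
      (hasLaw_arrayLaw hid) hind (arrayLaw_Iio hid h0) hlim 1)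
  simp_rw [measureReal_def, levyTail, map_mul_Ioi _ hσ2]
  exact tendsto_tail_mulMixture hρ (gammaMeasure_ae_pos _ _) integrable_id_gammaMeasure_half
    (gammaMeasure_singleton _ _) (isProbabilityMeasure_arrayLaw hid) hC
    (fun x hx hx0 => tendsto_tail_arrayLaw ha hρ hind hid h0 hlim hx hx0) (div_pos hx hσ2)

end ScaleMixtureNetwork

end

theorem mainTheorem4
    {Ω : Type*} [MeasurableSpace Ω] (P : Measure Ω) [IsProbabilityMeasure P]
    {Ω' : Type*} [MeasurableSpace Ω'] (P' : Measure Ω') [IsProbabilityMeasure P']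
    (a : ℝ) (ha : 0 ≤ a) (ρ : Measure ℝ) (hρ : IsLevyMeasure ρ) :
    -- the limit variables: nonnegative, non-degenerate at zero, explicit cdf
    (ρ ≠ 0 → ∀ k : ℕ, 1 ≤ k → ∀ G : Ω' → ℝ, HasLaw G (gammaMeasure k 1) P' →
      AEMeasurable (fun ω => invLevyTail ρ (G ω)) P' ∧
      (∀ᵐ ω ∂P', 0 ≤ invLevyTail ρ (G ω)) ∧
      ¬ (∀ᵐ ω ∂P', invLevyTail ρ (G ω) = 0) ∧
      (∀ x : ℝ, 0 < x → ρ {x} = 0 →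
        P'.real {ω | invLevyTail ρ (G ω) ≤ x} = poissonSum k (levyTail ρ x).toReal) ∧
      (levyTail ρ 0 < ∞ →
        P'.real {ω | invLevyTail ρ (G ω) ≤ 0} = poissonSum k (levyTail ρ 0).toReal) ∧
      (levyTail ρ 0 = ∞ → P'.real {ω | invLevyTail ρ (G ω) ≤ 0} = 0)) ∧
    -- extremes of triangular arrays
    (∀ X : (n : ℕ) → Fin n → Ω → ℝ,
      (∀ n, iIndepFun (X n) P) →
      (∀ n i j, IdentDistrib (X n i) (X n j) P P) →
      (∀ n j, ∀ᵐ ω ∂P, 0 ≤ X n j ω) →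
      TendstoID P (fun n ω => ∑ j, X n j ω) a ρ →
      (ρ = 0 → ∀ k : ℕ, 1 ≤ k →
        TendstoInMeasure P (fun n ω => orderStat (fun j => X n j ω) k) atTop (fun _ => 0)) ∧
      (ρ ≠ 0 → ∀ G : ℕ → Ω' → ℝ, IsUnitPoissonPoints P' G →
        (∀ k : ℕ, 1 ≤ k → HasLaw (G k) (gammaMeasure k 1) P') ∧
        TendstoInDistribution
          (fun n ω (i : ℕ) => orderStat (fun j => X n j ω) (i + 1)) atTop
          (fun ω (i : ℕ) => invLevyTail ρ (G (i + 1) ω)) (fun _ => P) P')) ∧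
    -- extremes of the per-node variances and of the incoming weights of a network
    (∀ (L din dout : ℕ) (σb σv : ℝ), 0 ≤ σb → 0 < σv →
      ∀ N : ScaleMixtureNetwork P L din dout σb σv,
      ∀ l : ℕ, 1 ≤ l → l ≤ L →
      TendstoID P (fun n ω => ∑ j, N.lam l n j ω) a ρ →
      (∀ k : ℕ, 1 ≤ k →
        (ρ = 0 →
          TendstoInMeasure P (fun n ω => orderStat (fun j => N.lam l n j ω) k) atTop
            (fun _ => 0)) ∧
        (ρ ≠ 0 → ∀ G : Ω' → ℝ, HasLaw G (gammaMeasure k 1) P' →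
          TendstoInDistribution (fun n ω => orderStat (fun j => N.lam l n j ω) k) atTop
            (fun ω => invLevyTail ρ (G ω)) (fun _ => P) P')) ∧
      (IsLevyMeasure (gammaMixture ρ) ∧ (gammaMixture ρ = 0 ↔ ρ = 0)) ∧
      (∀ m : ℕ, (l = L → m < dout) → ∀ k : ℕ, 1 ≤ k →
        (ρ = 0 →
          TendstoInMeasure P (fun n ω => orderStat (fun j => (N.W l n j m ω) ^ 2) k) atTop
            (fun _ => 0)) ∧
        (ρ ≠ 0 → ∀ G : Ω' → ℝ, HasLaw G (gammaMeasure k 1) P' →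
          TendstoInDistribution (fun n ω => orderStat (fun j => (N.W l n j m ω) ^ 2) k) atTop
            (fun ω => σv ^ 2 * invLevyTail (gammaMixture ρ) (G ω)) (fun _ => P) P'))) := by
  refine ⟨fun hne k hk G hG => ⟨?_, ?_, ?_, ?_, ?_, ?_⟩, ?_, ?_⟩
  · exact (measurable_invLevyTail hρ).comp_aemeasurable hG.aemeasurable
  · exact Eventually.of_forall fun ω => invLevyTail_nonneg ρ (G ω)
  · exact not_ae_invLevyTail_eq_zero hρ hne hk hG
  · exact fun x hx _ => measureReal_invLevyTail_le hρ hk hG hx.le (hρ.levyTail_lt_top hx)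
  · exact measureReal_invLevyTail_le hρ hk hG le_rfl
  · exact measureReal_invLevyTail_le_zero hρ hG
  · intro X hind hid h0 hlim
    have htail := fun x (hx : 0 < x) (hx0 : ρ {x} = 0) =>
      tendsto_tail_arrayLaw ha hρ hind hid h0 hlim hx hx0
    refine ⟨fun hz k hk => ?_, fun _ G hG => ⟨fun k hk => hG.hasLaw_gamma hk, ?_⟩⟩
    · exact tendstoInMeasure_orderStat (hasLaw_arrayLaw hid) h0 (tendsto_tail_zero hz htail) hk
    · exact tendstoInDistribution_orderStat hρ (isProbabilityMeasure_arrayLaw hid)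
        (hasLaw_arrayLaw hid) hind (arrayLaw_Iio hid h0) htail hG
  · intro L din dout σb σv _ hσv N l hl hlL hlim
    have hind := N.iIndepFun_lam hl hlL
    have hid := N.identDistrib_lam hl hlL
    have h0 := N.lam_nonneg hl hlL
    have htail := fun x (hx : 0 < x) (hx0 : ρ {x} = 0) =>
      tendsto_tail_arrayLaw ha hρ hind hid h0 hlim hx hx0
    have hγ : IsProbabilityMeasure (gammaMeasure (1 / 2) (1 / 2)) :=
      isProbabilityMeasure_gammaMeasure (by norm_num) (by norm_num)
    have hν : IsLevyMeasure (gammaMixture ρ) :=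
      hρ.mulMixture (gammaMeasure_ae_pos _ _) integrable_id_gammaMeasure_half
    refine ⟨fun k hk => ⟨fun hz => ?_, fun _ G hG => ?_⟩, ⟨hν, gammaMixture_eq_zero_iff hρ⟩,
      fun m hm k hk => ?_⟩
    · exact tendstoInMeasure_orderStat (hasLaw_arrayLaw hid) h0 (tendsto_tail_zero hz htail) hk
    · exact tendstoInDistribution_orderStat_single hρ (isProbabilityMeasure_arrayLaw hid)
        (hasLaw_arrayLaw hid) hind (arrayLaw_Iio hid h0) htail hk hG
    · have hσ2 : 0 < σv ^ 2 := by positivity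
      have hlawW := N.hasLaw_sq_W hl hlL hm
      have htailW := fun x (hx : 0 < x) (_ : (gammaMixture ρ).map (fun x => σv ^ 2 * x) {x} = 0) =>
        N.tendsto_tail_sq_W ha hρ hσv hl hlL hlim hx
      refine ⟨fun hz => ?_, fun _ G hG => ?_⟩
      · refine tendstoInMeasure_orderStat hlawW
          (fun n j => Eventually.of_forall fun ω => sq_nonneg _) (tendsto_tail_zero ?_ htailW) hk
        rw [(gammaMixture_eq_zero_iff hρ).2 hz, Measure.map_zero]
      · have hμ := isProbabilityMeasure_arrayLaw hid
        -- The limit is rewritten as the inverse tail of ν scaled by σ_v², the Lévy measure matching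
        -- the tails of the squared weights.
        simp_rw [← invLevyTail_map_mul _ hσ2]
        refine tendstoInDistribution_orderStat_single (hν.map_mul hσ2) (fun n => ?_) hlawW
          (N.iIndepFun_sq_W hl hlL hm) (fun n => ?_) htailW hk hG
        · have := hμ n
          have : IsProbabilityMeasure
              (mulMixture (gammaMeasure (1 / 2) (1 / 2)) (arrayLaw P (N.lam l) n)) :=
            Measure.isProbabilityMeasure_map (by fun_prop)
          exact Measure.isProbabilityMeasure_map (by fun_prop)
        · have := hμ n
          rw [Measure.map_apply (by fun_prop) measurableSet_Iio, mulMixture_apply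
            (measurableSet_Iio.preimage (by fun_prop))]
          refine (lintegral_congr_ae (g := fun _ => 0) ?_).trans lintegral_zero
          filter_upwards [gammaMeasure_ae_pos (1 / 2) (1 / 2)] with y hy
          refine measure_mono_null (fun w hw => ?_) (arrayLaw_Iio hid h0 n)
          simp only [mem_preimage, mem_ofPred_eq, mem_Iio] at hw ⊢
          by_contra! h
          have : 0 ≤ σv ^ 2 * (y * w) := by positivity
          linarith
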